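/- **Proportionality of characteristic polynomials and folding.** For a generalized Cartan matrix $K$, let $s_i$ be the reflection $\alpha_k\mapsto\alpha_k-K_{ik}\alpha_i$. A Coxeter transformation is the product $C$ of all the reflections $s_i$, in any order if the diagram is a tree; for the even cycle $\widetilde A_{2n-1}$ it is taken bicolored, $C=w_1w_2$, where $w_1,w_2$ are the products of the $s_i$ over the two parts of a bipartition of the vertices. Let $\mathcal X(\Gamma)(\lambda)=\det(\lambda-C)$ be its characteristic polynomial, and let $\widetilde\Gamma$ be the extended Dynkin diagram of $\Gamma$. Consider the pairs $(\Gamma,\Gamma^f)$ $$(D_4,G_2),\qquad (E_6,F_4),\qquad (D_{n+1},B_n)\ (n\ge 3),\qquad (A_{2n-1},C_n)\ (n\ge 2).$$ 1. In each case $\Gamma^f$ and $\widetilde\Gamma^f$ are obtained by folding from $\Gamma$ and $\widetilde\Gamma$: there is a diagram automorphism $\tau$ of $\Gamma$, extended to $\widetilde\Gamma$ by fixing the additional vertex, such that the Cartan matrices of $\Gamma^f$ and $\widetilde\Gamma^f$ arise from those of $\Gamma$ and $\widetilde\Gamma$ by summing the columns over the $\tau$-orbits. 2. $$\frac{\mathcal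 X(\Gamma)}{\mathcal X(\widetilde\Gamma)}=\frac{\mathcal X(\Gamma^f)}{\mathcal X(\widetilde\Gamma^f)}$$ as rational functions of $\lambda$, and the same holds with the Cartan matrices of both $\Gamma^f$ and $\widetilde\Gamma^f$ replaced by their transposes (the dual diagrams). The common values are: - $\dfrac{\lambda^3+1}{(\lambda^2-1)^2}$ for $D_4$ and $G_2$; - $\dfrac{\lambda^6+1}{(\lambda^4-1)(\lambda^3-1)}$ for $E_6$ and $F_4$; - $\dfrac{\lambda^n+1}{(\lambda^{n-1}-1)(\lambda^2-1)}$ for $D_{n+1}$ and $B_n$; - $\dfrac{\lambda^n+1}{(\lambda^n-1)(\lambda-1)}$ for $A_{2n-1}$ and $C_n$. 3. The Poincaré series coincide. Let $\pi_m$ be the representation of $SU(2)$ in $\mathrm{Sym}^m(\mathbb C^2)$, and let $H\le G$ be the following standard subgroups of $SU(2)$, in the order of the pairs above: $\mathcal D_2\le\mathcal T$, $\ \mathcal T\le\mathcal O$, $\ \mathcal D_{n-1}\le\mathcal D_{2(n-1)}$, $\ \mathbb Z/2n\mathbb Z\le\mathcal D_n$, where $\mathcal D_k$ is the binary dihedral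 group of order $4k$ and $\mathcal T$, $\mathcal O$ are the binary tetrahedral and octahedral groups. The Poincaré series $\sum_m\langle\pi_m|_H,\mathbf 1_H\rangle t^m$ belonging to $\Gamma$ and the generalized Poincaré series $\sum_m\langle\pi_m|_H,\mathbf 1_G{\downarrow^G_H}\rangle t^m$ and $\sum_m\langle\pi_m|_G,\mathbf 1_H{\uparrow^G_H}\rangle t^m$ belonging to $\Gamma^f$ (restriction and induction of the trivial representation) are equal, and equal to the common value in part 2 at $\lambda=t^2$. Here $\langle\pi,\sigma\rangle=\dim\mathrm{Hom}(\sigma,\pi)$. -/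

import Mathlib

open Matrix

namespace CoxeterFolding

/-! ### Coxeter transformations of generalized Cartan matrices -/

section Coxeter

variable {V W : Type*} [Fintype V] [DecidableEq V] [Fintype W] [DecidableEq W]

/-- The reflection `α_k ↦ α_k - K i k • α_i` in the simple root `α_i`, written in the basis of
simple roots (its columns are the images of the simple roots). -/
def simpleReflection (K : Matrix V V ℤ) (i : V) : Matrix V V ℤ :=
  Matrix.of fun j k => (if j = k then 1 else 0) - (if j = i then K i k else 0)

/-- `C` is a Coxeter transformation: the product, in some order, of the reflections in all the
simple roots, each taken once. -/
def IsCoxeter (K C : Matrix V V ℤ) : Prop :=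
  ∃ l : List V, l.Nodup ∧ (∀ v, v ∈ l) ∧ C = (l.map (simpleReflection K)).prod

/-- `C` is a bicolored Coxeter transformation `w₁ w₂`: the vertices are partitioned into two sets
(listed by `l₁` and `l₂`), all edges lead from the first set to the second one, and `w₁`, `w₂` are
the products of the simple reflections over the two sets. -/
def IsBicoloredCoxeter (K C : Matrix V V ℤ) : Prop :=
  ∃ l₁ l₂ : List V, (l₁ ++ l₂).Nodup ∧ (∀ v, v ∈ l₁ ++ l₂) ∧
    (∀ i ∈ l₁, ∀ j ∈ l₁, i ≠ j → K i j = 0) ∧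
    (∀ i ∈ l₂, ∀ j ∈ l₂, i ≠ j → K i j = 0) ∧
    C = (l₁.map (simpleReflection K)).prod * (l₂.map (simpleReflection K)).prod

/-- The characteristic polynomial `det (λ - C)`, as a rational function of `λ`. -/
noncomputable def charRat (C : Matrix V V ℤ) : RatFunc ℚ :=
  algebraMap (Polynomial ℚ) (RatFunc ℚ) (C.charpoly.map (Int.castRingHom ℚ))

/-- The quotient of the characteristic polynomials of `C` and `Ca`. -/
noncomputable def charRatio (C : Matrix V V ℤ) (Ca : Matrix W W ℤ) : RatFunc ℚ :=
  charRat C / charRat Ca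

/-- `L` is the folding of `K` along the diagram automorphism `τ`: the map `p` identifies the
`τ`-orbits with the vertices of `L`, and the entries of `L` are obtained by summing the columns of
`K` over the `τ`-orbits. -/
def IsFolding (K : Matrix V V ℤ) (τ : Equiv.Perm V) (p : V → W) (L : Matrix W W ℤ) : Prop :=
  (∀ i j, K (τ i) (τ j) = K i j) ∧ Function.Surjective p ∧
    (∀ i j, p i = p j ↔ τ.SameCycle i j) ∧
    ∀ i w, L (p i) w = ∑ j : V with p j = w, K i j

/-- Adjoin a vertex `none` to a Cartan matrix; `r` and `c` are the off-diagonal entries of the row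
and of the column of the new vertex. -/
def extend (K : Matrix V V ℤ) (r c : V → ℤ) : Matrix (Option V) (Option V) ℤ :=
  Matrix.of fun x y =>
    match x, y with
    | none, none => 2
    | none, some j => r j
    | some i, none => c i
    | some i, some j => K i j

end Coxeter

/-! ### Cartan matrices of the extended Dynkin diagrams

The finite Cartan matrices are those of Mathlib, with vertices numbered from `0`. -/

/-- The extended diagram of `A m`, `m ≥ 2`: a cycle with `m + 1` vertices. -/
def affineA (m : ℕ) : Matrix (Option (Fin m)) (Option (Fin m)) ℤ :=
  extend (CartanMatrix.A m)
    (fun j => if j.val = 0 ∨ j.val + 1 = m then -1 else 0)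
    (fun i => if i.val = 0 ∨ i.val + 1 = m then -1 else 0)

/-- The extended diagram of `B m`, `m ≥ 3`: the new vertex is joined by a simple edge to the
second vertex of the chain (a fork at one end, a double edge at the other one). -/
def affineB (m : ℕ) : Matrix (Option (Fin m)) (Option (Fin m)) ℤ :=
  extend (CartanMatrix.B m)
    (fun j => if j.val = 1 then -1 else 0)
    (fun i => if i.val = 1 then -1 else 0)

/-- The extended diagram of `C m`, `m ≥ 2`: the new vertex is joined to the first vertex of the
chain by a double edge (double edges at both ends). -/
def affineC (m : ℕ) : Matrix (Option (Fin m)) (Option (Fin m)) ℤ :=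
  extend (CartanMatrix.C m)
    (fun j => if j.val = 0 then -2 else 0)
    (fun i => if i.val = 0 then -1 else 0)

/-- The extended diagram of `D m`, `m ≥ 4`: forks at both ends. -/
def affineD (m : ℕ) : Matrix (Option (Fin m)) (Option (Fin m)) ℤ :=
  extend (CartanMatrix.D m)
    (fun j => if j.val = 1 then -1 else 0)
    (fun i => if i.val = 1 then -1 else 0)

/-- The extended diagram of `E₆`: three arms with two edges each. -/
def affineE₆ : Matrix (Option (Fin 6)) (Option (Fin 6)) ℤ :=
  extend CartanMatrix.E₆ ![0, -1, 0, 0, 0, 0] ![0, -1, 0, 0, 0, 0]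

/-- The extended diagram of `F₄`: a chain of five vertices whose third edge, counted from the new
vertex, is double. -/
def affineF₄ : Matrix (Option (Fin 4)) (Option (Fin 4)) ℤ :=
  extend CartanMatrix.F₄ ![-1, 0, 0, 0] ![-1, 0, 0, 0]

/-- The extended diagram of `G₂`: a chain of three vertices whose second edge, counted from the
new vertex, is triple. -/
def affineG₂ : Matrix (Option (Fin 2)) (Option (Fin 2)) ℤ :=
  extend CartanMatrix.G₂ ![-1, 0] ![-1, 0]

/-! ### Poincaré series of binary polyhedral groups -/

/-- The group `SU(2)`. -/
abbrev SU2 : Type := Matrix.specialUnitaryGroup (Fin 2) ℂ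

theorem mem_SU2 (a b : ℂ) (h : a * star a + b * star b = 1) :
    !![a, b; -star b, star a] ∈ Matrix.specialUnitaryGroup (Fin 2) ℂ := by
  rw [Matrix.mem_specialUnitaryGroup_iff, Matrix.mem_unitaryGroup_iff]
  refine ⟨?_, ?_⟩
  · ext i j
    fin_cases i <;> fin_cases j <;>
      simp [Matrix.mul_apply, Fin.sum_univ_two, Matrix.star_apply] <;>
      first
        | linear_combination h
        | (simp at h; linear_combination h)
        | ring
  · simp [Matrix.det_fin_two]
    simp at h
    linear_combination h

/-- The diagonal matrix with entries `exp (iθ)` and `exp (-iθ)`. -/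
noncomputable def diagSU (θ : ℝ) : SU2 :=
  ⟨!![Complex.exp (θ * Complex.I), 0; -star 0, star (Complex.exp (θ * Complex.I))],
    mem_SU2 _ _ (by
      rw [Complex.star_def, Complex.mul_conj, Complex.normSq_eq_norm_sq,
        Complex.norm_exp_ofReal_mul_I]
      simp)⟩

/-- The quaternion `j`. -/
noncomputable def jSU : SU2 :=
  ⟨!![0, 1; -star 1, star 0], mem_SU2 _ _ (by simp)⟩

/-- The quaternion `(1 + i + j + k) / 2`. -/
noncomputable def omegaSU : SU2 :=
  ⟨!![(1 + Complex.I) / 2, (1 + Complex.I) / 2;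
      -star ((1 + Complex.I) / 2), star ((1 + Complex.I) / 2)],
    mem_SU2 _ _ (by
      simp
      ring_nf
      simp
      norm_num)⟩

/-- The cyclic group of order `2 * n` in `SU(2)`. -/
noncomputable def cyclicGroup (n : ℕ) : Subgroup SU2 :=
  Subgroup.closure {diagSU (Real.pi / n)}

/-- The binary dihedral group of order `4 * n` in `SU(2)`. -/
noncomputable def binaryDihedral (n : ℕ) : Subgroup SU2 :=
  Subgroup.closure {diagSU (Real.pi / n), jSU}

/-- The binary tetrahedral group (of order `24`) in `SU(2)`. -/
noncomputable def binaryTetrahedral : Subgroup SU2 :=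
  Subgroup.closure {diagSU (Real.pi / 2), jSU, omegaSU}

/-- The binary octahedral group (of order `48`) in `SU(2)`. -/
noncomputable def binaryOctahedral : Subgroup SU2 :=
  Subgroup.closure {diagSU (Real.pi / 4), jSU, omegaSU}

/-- The action of an element of `SU(2)` on the symmetric algebra `Sym (ℂ²) = ℂ[x₁, x₂]` induced by its action
on `ℂ²`. -/
noncomputable def symAction (g : SU2) : MvPolynomial (Fin 2) ℂ →ₐ[ℂ] MvPolynomial (Fin 2) ℂ :=
  MvPolynomial.aeval fun j => ∑ i, MvPolynomial.C (g.1 i j) * MvPolynomial.X i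

/-- The representation of `SU(2)` in `Sym (ℂ²) = ℂ[x₁, x₂]`. -/
noncomputable def symAlgebra : Representation ℂ SU2 (MvPolynomial (Fin 2) ℂ) where
  toFun g := (symAction g).toLinearMap
  map_one' := by
    have : symAction 1 = AlgHom.id ℂ _ := by
      ext j
      simp [symAction, Matrix.one_apply]
    rw [this]
    rfl
  map_mul' g h := by
    have : symAction (g * h) = (symAction g).comp (symAction h) := by
      apply MvPolynomial.algHom_ext
      intro j
      simp only [symAction, MvPolynomial.aeval_X, AlgHom.comp_apply, map_mul,
        MvPolynomial.aeval_C, Submonoid.coe_mul, Matrix.mul_apply, Fin.sum_univ_two, map_add,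
        MvPolynomial.algebraMap_eq]
      ring
    rw [this]
    rfl

theorem isHomogeneous_symAction (g : SU2) {n : ℕ} {v : MvPolynomial (Fin 2) ℂ}
    (hv : v.IsHomogeneous n) : (symAction g v).IsHomogeneous n := by
  have h1 : ∀ j : Fin 2, (∑ i, MvPolynomial.C (g.1 i j) * MvPolynomial.X i :
      MvPolynomial (Fin 2) ℂ).IsHomogeneous 1 := fun j =>
    MvPolynomial.IsHomogeneous.sum _ _ _ fun i _ =>
      MvPolynomial.isHomogeneous_C_mul_X (g.1 i j) i
  have h2 := MvPolynomial.IsHomogeneous.aeval hv _ h1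
  rw [one_mul] at h2
  exact h2

/-- The representation `π_n` of `SU(2)` in `Sym^n (ℂ²)`. -/
noncomputable def symPower (n : ℕ) :
    Representation ℂ SU2 (MvPolynomial.homogeneousSubmodule (Fin 2) ℂ n) :=
  Subrepresentation.toRepresentation (ρ := symAlgebra)
    { toSubmodule := MvPolynomial.homogeneousSubmodule (Fin 2) ℂ n
      apply_mem_toSubmodule := fun g _ hv => isHomogeneous_symAction g hv }

/-- For a representation `σ` of a subgroup `H` of `SU(2)`, the generating function
`∑ ⟨π_n | H, σ⟩ t ^ n`, where `⟨π_n | H, σ⟩ = dim Hom_H (σ, π_n)`. -/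
noncomputable def multiplicitySeries (H : Subgroup SU2) {W : Type*} [AddCommGroup W] [Module ℂ W]
    (σ : Representation ℂ H W) : PowerSeries ℤ :=
  PowerSeries.mk fun n =>
    (Module.finrank ℂ (Representation.IntertwiningMap σ ((symPower n).comp H.subtype)) : ℤ)

/-- The Poincaré series of `H`: the generating function of the multiplicities of the trivial
representation of `H` in the `π_n | H`. -/
noncomputable def poincare (H : Subgroup SU2) : PowerSeries ℤ :=
  multiplicitySeries H (Representation.trivial ℂ H ℂ)

/-- The generalized Poincaré series of a pair `H ≤ G`: the generating function of
`⟨π_n | H, ρ₀↓⟩`, where `ρ₀↓` is the restriction to `H` of the trivial representation of `G`. -/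
noncomputable def poincareRes {H G : Subgroup SU2} (h : H ≤ G) : PowerSeries ℤ :=
  multiplicitySeries H ((Representation.trivial ℂ G ℂ).comp (Subgroup.inclusion h))

/-- The generalized Poincaré series of a pair `H ≤ G`: the generating function of
`⟨π_n | G, τ₀↑⟩`, where `τ₀↑` is the representation of `G` induced by the trivial representation
of `H`. -/
noncomputable def poincareInd {H G : Subgroup SU2} (h : H ≤ G) : PowerSeries ℤ :=
  multiplicitySeries G
    (Representation.ind (Subgroup.inclusion h) (Representation.trivial ℂ H ℂ))

end CoxeterFolding

open CoxeterFolding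

/-! The characteristic polynomials come from an elimination. Let U and L be the parts of `K`
strictly above and below the diagonal, in the order in which the reflections are multiplied. Then (1
+ U)C = -(1 + L), so det(λ - C) = det(λ(1 + U) + 1 + L) (`charRat_eq_det`). On a forest the vertices
can be eliminated from the leaves on (`det_eq_prod_of_forest`), with pivots d_v = λ + 1 - ∑ λ K_vc
K_cv / d_c over the neighbours c eliminated before v. Only the products K_vc K_cv enter, so neither
the order of the reflections nor transposition of `K` matters. If the root u is the neighbour of the
affine vertex, the quotient of the two characteristic polynomials is 1/e, where e is the pivot of
the affine vertex; it depends only on d_u and on the new edge (`IsPivots.charRatio_extend`). Folding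
replaces r equal branches at v by one branch with K_vc K_cv = r, which leaves d_u unchanged: this is
why the quotients agree.

The extension of A_{2n-1} is a cycle, not a tree. There the affine vertex is removed by an explicit
solution of the linear recursion along the remaining path; the bicolored order makes the
coefficients of this recursion alternate (`charRat_affineA`).

For the Poincaré series, the restricted trivial representation is again trivial, and Frobenius
reciprocity turns the induced one into the trivial representation of H. All three series are thus
the Hilbert series of the invariants of H in ℂ[x₀, x₁]; those of G are never needed. Cyclic
invariants are spanned by monomials, binary dihedral ones by monomials symmetrized under `jSU`. For
the binary tetrahedral group, the invariants of the quaternion group in degree 4k are the forms of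
degree k in two quartics, which `omegaSU` multiplies by primitive cube roots of unity, and those in
degree 4k + 6 are the same times an invariant sextic. So the tetrahedral count reduces to a cyclic
count modulo 3. -/

namespace CoxeterFolding

/-! ### Characteristic polynomials of Coxeter transformations -/

section Coxeter

variable {V : Type*} [Fintype V] [DecidableEq V]

theorem simpleReflection_mul_apply (K P : Matrix V V ℤ) (v i j : V) :
    (simpleReflection K v * P) i j = P i j - if i = v then (K * P) v j else 0 := by
  simp only [Matrix.mul_apply, simpleReflection, Matrix.of_apply, sub_mul, ite_mul, one_mul,
    zero_mul, Finset.sum_sub_distrib]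
  split_ifs <;> simp

theorem prod_simpleReflection_apply_of_notMem (K : Matrix V V ℤ) (l : List V) {i : V}
    (hi : i ∉ l) (j : V) :
    (l.map (simpleReflection K)).prod i j = (1 : Matrix V V ℤ) i j := by
  induction l with
  | nil => simp
  | cons v l ih =>
    simp only [List.mem_cons, not_or] at hi
    rw [List.map_cons, List.prod_cons, simpleReflection_mul_apply, if_neg hi.1, sub_zero, ih hi.2]

/-- The part of `K` above the diagonal, for the order in which the vertices appear in `l`. -/
def upperPart (K : Matrix V V ℤ) (l : List V) : Matrix V V ℤ :=
  Matrix.of fun i j => if j ∈ l ∧ l.idxOf i < l.idxOf j then K i j else 0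

/-- When `l` lists all vertices and the diagonal of `K` is 2, the right side is minus (1 + the
strictly lower part), so the Coxeter transformation is minus a quotient of unitriangular matrices.
The restriction to rows in `l` makes an induction on the list possible: reflections outside `l` have
not acted yet. -/
theorem one_add_upperPart_mul_prod (K : Matrix V V ℤ) (l : List V) (hl : l.Nodup) :
    (1 + upperPart K l) * (l.map (simpleReflection K)).prod =
      1 + upperPart K l - Matrix.of fun i j => if i ∈ l then K i j else 0 := by
  induction l with
  | nil =>
    ext i j
    simp [upperPart]
  | cons v l ih =>
    obtain ⟨hv, hl⟩ := List.nodup_cons.1 hl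
    have ih := ih hl
    set P := (l.map (simpleReflection K)).prod with hP
    have hU : ∀ i j, upperPart K (v :: l) i j =
        upperPart K l i j + if i = v then (if j ∈ l then K v j else 0) else 0 := by
      intro i j
      by_cases hi : i = v
      · subst hi
        by_cases hj : j = i
        · subst hj
          simp [upperPart, hv]
        · by_cases hjl : j ∈ l
          · have : ¬ l.idxOf i < l.idxOf j := by
              -- An absent vertex has `idxOf` equal to the length, so it precedes nothing and its
              -- row of `upperPart K l` vanishes.
              rw [List.idxOf_eq_length hv]
              exact not_lt.2 (List.idxOf_le_length)
            simp [upperPart, hj, hjl, List.idxOf_cons_ne _ (Ne.symm hj), this]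
          · simp [upperPart, hj, hjl]
      · by_cases hj : j = v
        · subst hj
          simp [upperPart, hv, hi]
        · simp [upperPart, hi, hj, List.idxOf_cons_ne _ (Ne.symm hi),
            List.idxOf_cons_ne _ (Ne.symm hj)]
    have hUv : ∀ i, upperPart K (v :: l) i v = 0 := by
      intro i
      simp [upperPart]
    -- Nothing precedes `v`, so column `v` of the left factor is a unit vector and the reflection
    -- changes only row `v`.
    have h1 : (1 + upperPart K (v :: l)) * simpleReflection K v =
        1 + upperPart K (v :: l) - Matrix.of fun i j => if i = v then K i j else 0 := by
      ext i j
      simp only [Matrix.mul_apply, simpleReflection, Matrix.of_apply, mul_sub, mul_ite, mul_one,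
        mul_zero, Finset.sum_sub_distrib, Matrix.sub_apply, Matrix.add_apply]
      by_cases hi : i = v <;> simp [hUv, Matrix.one_apply, hi]
    have h2 : (1 + upperPart K (v :: l) - Matrix.of fun i j => if i = v then K i j else 0 :
        Matrix V V ℤ) = 1 + upperPart K l -
          Matrix.of fun i j => if i = v then (if j ∈ l then 0 else K v j) else 0 := by
      ext i j
      simp only [Matrix.sub_apply, Matrix.add_apply, hU, Matrix.of_apply]
      split_ifs <;> simp_all; ring
    -- The correction row is supported on columns outside `l`, and there the rows of the remaining
    -- product are those of the identity.
    have h3 : (Matrix.of fun i j => if i = v then (if j ∈ l then 0 else K v j) else 0 :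
        Matrix V V ℤ) * P =
          Matrix.of fun i j => if i = v then (if j ∈ l then 0 else K v j) else 0 := by
      ext i j
      simp only [Matrix.mul_apply, Matrix.of_apply]
      by_cases hi : i = v
      · simp only [hi, if_true]
        have : ∀ x, (if x ∈ l then 0 else K v x) * P x j =
            (if x ∈ l then 0 else K v x) * (1 : Matrix V V ℤ) x j := by
          intro x
          by_cases hx : x ∈ l
          · simp [hx]
          · rw [hP, prod_simpleReflection_apply_of_notMem K l hx]
        simp only [this]
        simp [Matrix.one_apply]
      · simp [hi]
    rw [List.map_cons, List.prod_cons, ← Matrix.mul_assoc, h1, h2, sub_mul, ih, h3]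
    ext i j
    simp only [Matrix.sub_apply, Matrix.add_apply, hU, Matrix.of_apply, List.mem_cons]
    by_cases hi : i = v
    · subst hi
      by_cases hj : j ∈ l <;> simp [hv, hj]; ring
    · simp [hi]

/-! ### Determinants by elimination along a forest -/

theorem det_eq_one_of_upper {R : Type*} [CommRing R] (N : Matrix V V R) (f : V → ℤ)
    (hf : f.Injective) (h1 : ∀ i, N i i = 1) (h2 : ∀ i j, f j < f i → N i j = 0) :
    N.det = 1 := by
  let _ : LinearOrder V := LinearOrder.lift' f hf
  have h : N.BlockTriangular id := fun i j hij => h2 i j hij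
  have := Matrix.det_of_isUpperTriangular h
  simp only [h1, Finset.prod_const_one] at this
  convert this

/-- The `LDU` decomposition of a matrix whose graph is a forest. -/
theorem det_eq_prod_of_forest {F : Type*} [Field F] (M : Matrix V V F) (f : V → ℤ)
    (hf : f.Injective) (d : V → F) (hd : ∀ v, d v ≠ 0)
    (hM : ∀ c v w, v ≠ w → f c < f v → f c < f w → M v c * M c w = 0)
    (hdM : ∀ v, M v v = d v + ∑ c, if f c < f v then M v c * M c v / d c else 0) :
    M.det = ∏ v, d v := by
  let U : Matrix V V F := Matrix.of fun v c =>
    if v = c then 1 else if f c < f v then M v c / d c else 0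
  let L : Matrix V V F := Matrix.of fun c w =>
    if c = w then 1 else if f c < f w then M c w / d c else 0
  have hL : L.det = 1 := det_eq_one_of_upper L f hf (by simp [L]) fun i j hij => by
    have : i ≠ j := by rintro rfl; exact lt_irrefl _ hij
    simp [L, this, hij.le.not_gt]
  have hU : U.det = 1 := by
    rw [← Matrix.det_transpose]
    refine det_eq_one_of_upper _ f hf (by simp [U]) fun i j hij => ?_
    have : j ≠ i := by rintro rfl; exact lt_irrefl _ hij
    simp [U, this, hij.le.not_gt]
  have h : M = U * Matrix.diagonal d * L := by
    ext v w
    rw [Matrix.mul_apply]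
    simp only [Matrix.mul_diagonal]
    -- By `hM`, a vertex `c` below two different vertices contributes nothing. What remains is `c =
    -- v`, `c = w`, and for `v = w` the diagonal corrections accounted for by `hdM`.
    have hsplit : ∀ c, U v c * d c * L c w =
        (if c = v then (if v = w then d v else if f v < f w then M v w else 0) else 0) +
        (if c = w then (if v = w then 0 else if f w < f v then M v w else 0) else 0) +
        (if v = w then (if f c < f v then M v c * M c v / d c else 0) else 0) := by
      intro c
      by_cases hcv : c = v
      · subst hcv
        by_cases hcw : c = w
        · subst hcw
          simp [U, L]
        · simp only [U, L, Matrix.of_apply, if_true, hcw, if_false]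
          split_ifs <;> simp
          field_simp [hd]
      · by_cases hcw : c = w
        · subst hcw
          simp only [U, L, Matrix.of_apply, if_true, hcv, if_false, Ne.symm hcv]
          split_ifs <;> simp
          field_simp [hd]
        · by_cases hvw : v = w
          · subst hvw
            simp only [U, L, Matrix.of_apply, if_true, hcv, if_false, Ne.symm hcv]
            split_ifs <;> simp
            field_simp [hd]
          · simp only [U, L, Matrix.of_apply, hcv, hcw, if_false, Ne.symm hcv, hvw]
            split_ifs with h1 h2
            · have := hM c v w hvw h1 h2
              field_simp [hd]
              simpa using this
            all_goals simp
    simp only [hsplit, Finset.sum_add_distrib, Finset.sum_ite_eq', Finset.mem_univ, if_true]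
    by_cases hvw : v = w
    · subst hvw
      simp [hdM v]
    · simp only [hvw, if_false, Finset.sum_const_zero, add_zero]
      rcases lt_trichotomy (f v) (f w) with h | h | h
      · simp [h, h.le.not_gt]
      · exact absurd (hf h) hvw
      · simp [h, h.le.not_gt]
  rw [h, Matrix.det_mul, Matrix.det_mul, hU, hL, Matrix.det_diagonal]
  simp

/-- The matrix whose determinant is the characteristic polynomial of the Coxeter
transformation attached to the list `l`. -/
noncomputable def coxeterMatrix (K : Matrix V V ℤ) (l : List V) : Matrix V V (RatFunc ℚ) :=
  Matrix.of fun i j =>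
    if i = j then RatFunc.X + 1
    else (if l.idxOf i < l.idxOf j then RatFunc.X else 1) * (K i j : RatFunc ℚ)

/-- Multiplication of λ - C by 1 + U, of determinant one, gives λ(1 + U) - (1 + U - K). Above the
diagonal K_ij acquires the factor λ, below it stays, and the diagonal becomes λ - 1 + 2. -/
theorem charRat_eq_det (K : Matrix V V ℤ) (hK : ∀ i, K i i = 2) (l : List V) (hl : l.Nodup)
    (hmem : ∀ v, v ∈ l) :
    charRat (l.map (simpleReflection K)).prod = (coxeterMatrix K l).det := by
  set C := (l.map (simpleReflection K)).prod with hC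
  let φ : ℤ →+* RatFunc ℚ := Int.castRingHom (RatFunc ℚ)
  have hch : charRat C = ((RatFunc.X : RatFunc ℚ) • (1 : Matrix V V (RatFunc ℚ)) - C.map φ).det := by
    have h1 : C.charpoly.map (Int.castRingHom ℚ) = (C.map (Int.castRingHom ℚ)).charpoly :=
      (Matrix.charpoly_map _ _).symm
    rw [charRat, h1, Matrix.charpoly, RingHom.map_det]
    congr 1
    ext i j
    by_cases hij : i = j
    · subst hij
      simp [φ]
    · simp [φ, hij]
  have hdet : ((1 : Matrix V V (RatFunc ℚ)) + (upperPart K l).map φ).det = 1 := by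
    refine det_eq_one_of_upper _ (fun v => (l.idxOf v : ℤ)) ?_ ?_ ?_
    · intro i j hij
      exact (List.idxOf_inj (hmem i)).1 (Nat.cast_injective (R := ℤ) hij)
    · intro i
      simp [upperPart]
    · intro i j hij
      have hij : l.idxOf j < l.idxOf i := by exact_mod_cast hij
      have : i ≠ j := by rintro rfl; exact lt_irrefl _ hij
      simp [upperPart, this, hij.le.not_gt]
  have key := congrArg (fun A : Matrix V V ℤ => A.map φ) (one_add_upperPart_mul_prod K l hl)
  have hφ : ∀ A B : Matrix V V ℤ, (A * B).map φ = A.map φ * B.map φ := fun A B =>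
    Matrix.map_mul
  rw [hch, ← one_mul (Matrix.det (_ - _)), ← hdet, ← Matrix.det_mul, Matrix.mul_sub]
  congr 1
  have key' : ((1 : Matrix V V (RatFunc ℚ)) + (upperPart K l).map φ) * C.map φ =
      1 + (upperPart K l).map φ - K.map φ := by
    rw [← hC] at key
    simp only [hφ] at key
    have e1 : (1 + upperPart K l).map φ =
        (1 : Matrix V V (RatFunc ℚ)) + (upperPart K l).map φ := by
      ext i j
      by_cases hij : i = j <;> simp [hij]
    rw [e1] at key
    rw [key]
    ext i j
    by_cases hij : i = j <;> simp [hij, hmem]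
  rw [key']
  ext i j
  simp only [coxeterMatrix, Matrix.of_apply, Matrix.mul_smul, Matrix.mul_one, Matrix.sub_apply,
    Matrix.smul_apply, Matrix.add_apply, Matrix.map_apply, upperPart, hmem, true_and, smul_eq_mul]
  by_cases hij : i = j
  · subst hij
    simp [hK, φ]
    ring
  · by_cases hlt : l.idxOf i < l.idxOf j
    · simp [hij, hlt, φ]
    · simp [hij, hlt, φ]

omit [Fintype V] in
-- Exactly one of the two entries carries λ, whichever of the vertices comes first. Hence the order
-- of the reflections is irrelevant on a forest.
theorem coxeterMatrix_mul_coxeterMatrix (K : Matrix V V ℤ) (l : List V) (hmem : ∀ v, v ∈ l)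
    {i j : V} (hij : i ≠ j) :
    coxeterMatrix K l i j * coxeterMatrix K l j i =
      RatFunc.X * ((K i j * K j i : ℤ) : RatFunc ℚ) := by
  have h2 : l.idxOf i ≠ l.idxOf j := fun h => hij ((List.idxOf_inj (hmem i)).1 h)
  simp only [coxeterMatrix, Matrix.of_apply, hij, hij.symm, if_false]
  push_cast
  rcases lt_or_gt_of_ne h2 with h | h
  · simp only [h, h.le.not_gt, if_true, if_false]
    ring
  · have h' : l.idxOf j < l.idxOf i := h
    simp only [h', h'.le.not_gt, if_true, if_false]
    ring

/-- A forest structure on the diagram of `K`, given by an ordering `f` of the vertices, together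
with the pivots `d` of the elimination of the vertices in this order. -/
structure IsPivots (K : Matrix V V ℤ) (f : V → ℤ) (d : V → RatFunc ℚ) : Prop where
  diag : ∀ i, K i i = 2
  inj : f.Injective
  ne_zero : ∀ v, d v ≠ 0
  forest : ∀ c v w, v ≠ w → f c < f v → f c < f w → K v c * K c w = 0
  pivot : ∀ v, RatFunc.X + 1 =
      d v + ∑ c, if f c < f v then RatFunc.X * ((K v c * K c v : ℤ) : RatFunc ℚ) / d c else 0

omit [DecidableEq V] in
-- The pivots see only the symmetric products K_vc K_cv; the dual diagrams are thereby covered.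
theorem IsPivots.transpose {K : Matrix V V ℤ} {f : V → ℤ} {d : V → RatFunc ℚ}
    (h : IsPivots K f d) : IsPivots Kᵀ f d where
  diag := h.diag
  inj := h.inj
  ne_zero := h.ne_zero
  forest c v w hvw hv hw := by
    rw [Matrix.transpose_apply, Matrix.transpose_apply, mul_comm]
    exact h.forest c w v hvw.symm hw hv
  pivot v := by
    simp only [Matrix.transpose_apply]
    simp only [mul_comm (K _ v)]
    exact h.pivot v

/-- The characteristic polynomial of a Coxeter transformation whose diagram is a forest, by
elimination of the vertices. -/
theorem IsPivots.charRat_eq {K C : Matrix V V ℤ} {f : V → ℤ} {d : V → RatFunc ℚ}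
    (h : IsPivots K f d) (hC : IsCoxeter K C) : charRat C = ∏ v, d v := by
  obtain ⟨l, hl, hmem, rfl⟩ := hC
  rw [charRat_eq_det K h.diag l hl hmem]
  refine det_eq_prod_of_forest _ f h.inj d h.ne_zero ?_ ?_
  · intro c v w hvw hv hw
    have h1 : v ≠ c := by rintro rfl; exact lt_irrefl _ hv
    have h2 : c ≠ w := by rintro rfl; exact lt_irrefl _ hw
    have h3 : (K v c : RatFunc ℚ) * (K c w : RatFunc ℚ) = 0 := by
      exact_mod_cast congrArg (Int.cast : ℤ → RatFunc ℚ) (h.forest c v w hvw hv hw)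
    simp only [coxeterMatrix, Matrix.of_apply, h1, h2, if_false]
    linear_combination (if l.idxOf v < l.idxOf c then (RatFunc.X : RatFunc ℚ) else 1) *
      (if l.idxOf c < l.idxOf w then RatFunc.X else 1) * h3
  · intro v
    have hvv : coxeterMatrix K l v v = RatFunc.X + 1 := by simp [coxeterMatrix]
    rw [hvv, h.pivot v]
    congr 1
    refine Finset.sum_congr rfl fun c _ => ?_
    split_ifs with hcv
    · have h1 : v ≠ c := by rintro rfl; exact lt_irrefl _ hcv
      rw [coxeterMatrix_mul_coxeterMatrix K l hmem h1]
    · rfl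

omit [DecidableEq V] in
/-- Adjoining a vertex which is joined to the root `u` of a tree only. -/
theorem IsPivots.extend {K : Matrix V V ℤ} {f : V → ℤ} {d : V → RatFunc ℚ}
    (h : IsPivots K f d) {u : V} (hu : ∀ v, f v ≤ f u) {r c : V → ℤ}
    (hr : ∀ v, v ≠ u → r v = 0) {e : RatFunc ℚ} (he : e ≠ 0)
    (hde : RatFunc.X + 1 = e + RatFunc.X * ((r u * c u : ℤ) : RatFunc ℚ) / d u)
    (hc : ∀ v, v ≠ u → c v = 0) :
    IsPivots (extend K r c) (fun v => v.elim (f u + 1) f) (fun v => v.elim e d) where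
  diag := by
    rintro (_ | v)
    · rfl
    · exact h.diag v
  inj := by
    rintro (_ | v) (_ | w) hvw
    · rfl
    · have : f u + 1 = f w := hvw
      have := hu w
      omega
    · have : f v = f u + 1 := hvw
      have := hu v
      omega
    · exact congrArg some (h.inj hvw)
  ne_zero := by
    rintro (_ | v)
    · exact he
    · exact h.ne_zero v
  forest := by
    rintro (_ | c') (_ | v) (_ | w) hvw hv hw
    · exact absurd rfl hvw
    · exact absurd hv (lt_irrefl _)
    · exact absurd hw (lt_irrefl _)
    · have : f u + 1 < f v := hv
      have := hu v
      omega
    · exact absurd rfl hvw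
    · change r c' * K c' w = 0
      -- A vertex eliminated before another old vertex cannot be the root `u`, the only neighbour of
      -- the new vertex.
      have h1 : f c' < f w := hw
      rw [hr c', zero_mul]
      rintro rfl
      exact absurd (hu w) (not_le.2 h1)
    · change K v c' * c c' = 0
      have h1 : f c' < f v := hv
      rw [hc c', mul_zero]
      rintro rfl
      exact absurd (hu v) (not_le.2 h1)
    · exact h.forest c' v w (fun h => hvw (congrArg some h)) hv hw
  pivot := by
    rintro (_ | v)
    · simp only [Fintype.sum_option, Option.elim_none, Option.elim_some, lt_irrefl, if_false,
        zero_add]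
      rw [hde]
      congr 1
      rw [Finset.sum_eq_single u]
      · simp [CoxeterFolding.extend]
      · intro v _ hv
        simp [CoxeterFolding.extend, hr v hv]
      · simp
    · have : ¬ f u + 1 < f v := by have := hu v; omega
      simp only [Fintype.sum_option, Option.elim_none, Option.elim_some, this, if_false, zero_add]
      exact h.pivot v

/-- The quotient of the characteristic polynomials for a tree and the tree extended by a vertex
joined to its root only depends on the pivot of the root. -/
theorem IsPivots.charRatio_extend {K : Matrix V V ℤ} {f : V → ℤ} {d : V → RatFunc ℚ}
    (h : IsPivots K f d) {u : V} (hu : ∀ v, f v ≤ f u) {r c : V → ℤ}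
    (hr : ∀ v, v ≠ u → r v = 0) (hc : ∀ v, v ≠ u → c v = 0) {e : RatFunc ℚ} (he : e ≠ 0)
    (hde : RatFunc.X + 1 = e + RatFunc.X * ((r u * c u : ℤ) : RatFunc ℚ) / d u)
    {C : Matrix V V ℤ} {Ca : Matrix (Option V) (Option V) ℤ}
    (hC : (IsCoxeter K C ∧ IsCoxeter (CoxeterFolding.extend K r c) Ca) ∨
      (IsCoxeter Kᵀ C ∧ IsCoxeter (CoxeterFolding.extend K r c)ᵀ Ca)) :
    charRatio C Ca = 1 / e := by
  have h' := h.extend hu hr he hde hc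
  have hd : (∏ v, d v) ≠ 0 := Finset.prod_ne_zero_iff.2 fun v _ => h.ne_zero v
  have key : charRat C = ∏ v, d v ∧ charRat Ca = e * ∏ v, d v := by
    rcases hC with ⟨h1, h2⟩ | ⟨h1, h2⟩
    · refine ⟨h.charRat_eq h1, (h'.charRat_eq h2).trans ?_⟩
      rw [Fintype.prod_option]
      rfl
    · refine ⟨h.transpose.charRat_eq h1, (h'.transpose.charRat_eq h2).trans ?_⟩
      rw [Fintype.prod_option]
      rfl
  rw [charRatio, key.1, key.2]
  field_simp

end Coxeter

/-- The point 2 serves for every denominator that occurs: λ^k + 1, λ² + λ + 1, and λ^k - 1 with k ≠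
0 are positive there. -/
theorem ratFunc_ne_zero_of_eval (p : Polynomial ℚ) (hp : p.eval 2 ≠ 0) :
    algebraMap (Polynomial ℚ) (RatFunc ℚ) p ≠ 0 := by
  rw [Ne, map_eq_zero_iff _ (RatFunc.algebraMap_injective ℚ)]
  rintro rfl
  simp at hp

theorem X_pow_add_one_ne_zero (k : ℕ) : (RatFunc.X ^ k + 1 : RatFunc ℚ) ≠ 0 := by
  have := ratFunc_ne_zero_of_eval (Polynomial.X ^ k + 1) (by simp; positivity)
  simpa using this

theorem X_add_one_ne_zero : (RatFunc.X + 1 : RatFunc ℚ) ≠ 0 := by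
  simpa using X_pow_add_one_ne_zero 1

theorem X_pow_sub_one_ne_zero {k : ℕ} (hk : k ≠ 0) : (RatFunc.X ^ k - 1 : RatFunc ℚ) ≠ 0 := by
  have := ratFunc_ne_zero_of_eval (Polynomial.X ^ k - 1) (by
    have : (1 : ℚ) < 2 ^ k := one_lt_pow₀ (by norm_num) hk
    simp
    linarith)
  simpa using this

theorem X_sub_one_ne_zero : (RatFunc.X - 1 : RatFunc ℚ) ≠ 0 := by
  simpa using X_pow_sub_one_ne_zero one_ne_zero

/-! ### The exceptional diagrams -/

/-- The root 0 is the vertex that the affine vertex meets. Its pivot is λ + 1 - 3λ/(λ + 1) = (λ² - λ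
+ 1)/(λ + 1), with numerator and denominator multiplied by λ + 1. -/
theorem isPivots_G₂ : IsPivots CartanMatrix.G₂ ![1, 0]
    ![(RatFunc.X ^ 3 + 1) / (RatFunc.X + 1) ^ 2, RatFunc.X + 1] where
  diag := by decide
  inj := by decide
  ne_zero := by
    intro v
    fin_cases v
    · exact div_ne_zero (X_pow_add_one_ne_zero 3) (pow_ne_zero _ X_add_one_ne_zero)
    · exact X_add_one_ne_zero
  forest := by decide
  pivot := by
    have h1 := X_add_one_ne_zero
    intro v
    fin_cases v
    · simp [CartanMatrix.G₂, Fin.sum_univ_succ]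
      field_simp
      ring
    · simp [CartanMatrix.G₂, Fin.sum_univ_succ]

theorem X_sq_add_X_add_one_ne_zero : (RatFunc.X ^ 2 + RatFunc.X + 1 : RatFunc ℚ) ≠ 0 := by
  have := ratFunc_ne_zero_of_eval (Polynomial.X ^ 2 + Polynomial.X + 1) (by simp; norm_num)
  simpa using this

/-- Elimination runs from vertex 3 to the root 0. The double edge between 1 and 2 contributes 2λ/d₂,
and the last numerator λ⁴ - λ² + 1 is (λ⁶ + 1)/(λ² + 1). -/
theorem isPivots_F₄ : IsPivots CartanMatrix.F₄ ![4, 3, 2, 1]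
    ![(RatFunc.X ^ 6 + 1) / ((RatFunc.X ^ 2 + 1) * (RatFunc.X ^ 3 + 1)),
      (RatFunc.X ^ 3 + 1) / (RatFunc.X ^ 2 + RatFunc.X + 1),
      (RatFunc.X ^ 2 + RatFunc.X + 1) / (RatFunc.X + 1), RatFunc.X + 1] where
  diag := by decide
  inj := by decide
  ne_zero := by
    have h1 := X_add_one_ne_zero
    have h2 := X_sq_add_X_add_one_ne_zero
    have h3 := X_pow_add_one_ne_zero
    intro v
    fin_cases v
    · exact div_ne_zero (h3 6) (mul_ne_zero (h3 2) (h3 3))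
    · exact div_ne_zero (h3 3) h2
    · exact div_ne_zero h2 h1
    · exact h1
  forest := by decide
  pivot := by
    have h1 := X_add_one_ne_zero
    have h2 := X_sq_add_X_add_one_ne_zero
    have h3 := X_pow_add_one_ne_zero 3
    have h4 := X_pow_add_one_ne_zero 2
    have h5 : (RatFunc.X * (RatFunc.X + 1) + 1 : RatFunc ℚ) ≠ 0 := by
      convert h2 using 1
      ring
    intro v
    fin_cases v <;> simp [CartanMatrix.F₄, Fin.sum_univ_succ] <;> field_simp <;> ring

/-- The branches 0, 2 and 5, 4 both have the pivots of the end 3, 2 of F₄. At vertex 3 they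
contribute λ/d twice, which is what the double edge of F₄ contributes; from there on the pivots
coincide. -/
theorem isPivots_E₆ : IsPivots CartanMatrix.E₆ ![1, 6, 3, 5, 4, 2]
    ![RatFunc.X + 1, (RatFunc.X ^ 6 + 1) / ((RatFunc.X ^ 2 + 1) * (RatFunc.X ^ 3 + 1)),
      (RatFunc.X ^ 2 + RatFunc.X + 1) / (RatFunc.X + 1),
      (RatFunc.X ^ 3 + 1) / (RatFunc.X ^ 2 + RatFunc.X + 1),
      (RatFunc.X ^ 2 + RatFunc.X + 1) / (RatFunc.X + 1), RatFunc.X + 1] where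
  diag := by decide
  inj := by decide
  ne_zero := by
    have h1 := X_add_one_ne_zero
    have h2 := X_sq_add_X_add_one_ne_zero
    have h3 := X_pow_add_one_ne_zero
    intro v
    fin_cases v
    · exact h1
    · exact div_ne_zero (h3 6) (mul_ne_zero (h3 2) (h3 3))
    · exact div_ne_zero h2 h1
    · exact div_ne_zero (h3 3) h2
    · exact div_ne_zero h2 h1
    · exact h1
  forest := by decide
  pivot := by
    have h1 := X_add_one_ne_zero
    have h2 := X_sq_add_X_add_one_ne_zero
    have h3 := X_pow_add_one_ne_zero 3
    have h4 := X_pow_add_one_ne_zero 2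
    have h5 : (RatFunc.X * (RatFunc.X + 1) + 1 : RatFunc ℚ) ≠ 0 := by
      convert h2 using 1
      ring
    intro v
    fin_cases v <;> simp [CartanMatrix.E₆, Fin.sum_univ_succ] <;> field_simp <;> ring

theorem charRatio_G₂ {C : Matrix (Fin 2) (Fin 2) ℤ}
    {Ca : Matrix (Option (Fin 2)) (Option (Fin 2)) ℤ}
    (hC : (IsCoxeter CartanMatrix.G₂ C ∧ IsCoxeter affineG₂ Ca) ∨
      (IsCoxeter CartanMatrix.G₂ᵀ C ∧ IsCoxeter affineG₂ᵀ Ca)) :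
    charRatio C Ca = (RatFunc.X ^ 3 + 1) / (RatFunc.X ^ 2 - 1) ^ 2 := by
  have h1 := X_add_one_ne_zero
  have h2 := X_sub_one_ne_zero
  have h3 := X_pow_add_one_ne_zero 3
  have h4 := X_pow_sub_one_ne_zero two_ne_zero
  rw [isPivots_G₂.charRatio_extend (u := 0) (by decide) (by decide) (by decide)
    (e := (RatFunc.X ^ 2 - 1) ^ 2 / (RatFunc.X ^ 3 + 1)) (div_ne_zero (pow_ne_zero _ h4) h3) ?_ hC,
    one_div_div]
  simp
  field_simp
  ring

theorem charRatio_F₄ {C : Matrix (Fin 4) (Fin 4) ℤ}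
    {Ca : Matrix (Option (Fin 4)) (Option (Fin 4)) ℤ}
    (hC : (IsCoxeter CartanMatrix.F₄ C ∧ IsCoxeter affineF₄ Ca) ∨
      (IsCoxeter CartanMatrix.F₄ᵀ C ∧ IsCoxeter affineF₄ᵀ Ca)) :
    charRatio C Ca = (RatFunc.X ^ 6 + 1) / ((RatFunc.X ^ 4 - 1) * (RatFunc.X ^ 3 - 1)) := by
  have h3 := X_pow_add_one_ne_zero 6
  have h4 := X_pow_sub_one_ne_zero four_ne_zero
  have h5 := X_pow_sub_one_ne_zero three_ne_zero
  rw [isPivots_F₄.charRatio_extend (u := 0) (by decide) (by decide) (by decide)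
    (e := ((RatFunc.X ^ 4 - 1) * (RatFunc.X ^ 3 - 1)) / (RatFunc.X ^ 6 + 1))
    (div_ne_zero (mul_ne_zero h4 h5) h3) ?_ hC, one_div_div]
  simp
  field_simp
  ring

theorem charRatio_E₆ {C : Matrix (Fin 6) (Fin 6) ℤ}
    {Ca : Matrix (Option (Fin 6)) (Option (Fin 6)) ℤ}
    (hC : IsCoxeter CartanMatrix.E₆ C) (hCa : IsCoxeter affineE₆ Ca) :
    charRatio C Ca = (RatFunc.X ^ 6 + 1) / ((RatFunc.X ^ 4 - 1) * (RatFunc.X ^ 3 - 1)) := by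
  have h3 := X_pow_add_one_ne_zero 6
  have h4 := X_pow_sub_one_ne_zero four_ne_zero
  have h5 := X_pow_sub_one_ne_zero three_ne_zero
  rw [isPivots_E₆.charRatio_extend (u := 1) (by decide) (by decide) (by decide)
    (e := ((RatFunc.X ^ 4 - 1) * (RatFunc.X ^ 3 - 1)) / (RatFunc.X ^ 6 + 1))
    (div_ne_zero (mul_ne_zero h4 h5) h3) ?_ (Or.inl ⟨hC, hCa⟩), one_div_div]
  simp
  field_simp
  ring

/-! ### The diagrams with a chain that ends in a double edge or a fork -/

/-- The pivots of a chain which ends in a double edge or a fork after the vertex `k - 1`. -/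
noncomputable def chainPivot (k v : ℕ) : RatFunc ℚ :=
  if v < k then (RatFunc.X ^ (k + 1 - v) + 1) / (RatFunc.X ^ (k - v) + 1) else RatFunc.X + 1

theorem chainPivot_ne_zero (k v : ℕ) : chainPivot k v ≠ 0 := by
  unfold chainPivot
  split_ifs
  · exact div_ne_zero (X_pow_add_one_ne_zero _) (X_pow_add_one_ne_zero _)
  · exact X_add_one_ne_zero

/-- The pivots are quotients of consecutive terms of q_j = λ^j + 1, which satisfies (λ + 1) q_j =
q_{j+1} + λ q_{j-1}. -/
theorem chainPivot_step {k v : ℕ} (hv : v + 1 < k) :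
    RatFunc.X + 1 = chainPivot k v + RatFunc.X / chainPivot k (v + 1) := by
  obtain ⟨j, rfl⟩ : ∃ j, k = v + j + 2 := ⟨k - v - 2, by omega⟩
  have h1 := X_pow_add_one_ne_zero (j + 2)
  have h2 := X_pow_add_one_ne_zero (j + 1)
  have e1 : v + j + 2 + 1 - v = j + 3 := by omega
  have e2 : v + j + 2 - v = j + 2 := by omega
  have e3 : v + j + 2 + 1 - (v + 1) = j + 2 := by omega
  have e4 : v + j + 2 - (v + 1) = j + 1 := by omega
  rw [chainPivot, chainPivot, if_pos (by omega), if_pos hv, e1, e2, e3, e4]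
  field_simp
  ring

/-- Here the recursion reaches q₀ = 2 and q₁ = λ + 1. The 2 is supplied alike by a double edge and
by two leaves, so B, C and D share their chain pivots. -/
theorem chainPivot_end {k v : ℕ} (hv : v + 1 = k) :
    RatFunc.X + 1 = chainPivot k v + 2 * RatFunc.X / (RatFunc.X + 1) := by
  subst hv
  have h1 := X_add_one_ne_zero
  have e1 : v + 1 + 1 - v = 2 := by omega
  have e2 : v + 1 - v = 1 := by omega
  rw [chainPivot, if_pos (by omega), e1, e2]
  field_simp
  ring

/-- The diagram of `K` consists of a chain `0, …, k - 1` and of a double edge or a fork that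
joins `k - 1` to the remaining vertices. -/
structure IsChain {m : ℕ} (K : Matrix (Fin m) (Fin m) ℤ) (k : ℕ) : Prop where
  lt : k < m
  diag : ∀ i, K i i = 2
  forest : ∀ c v w, v ≠ w → v < c → w < c → K v c * K c w = 0
  chain : ∀ v c : Fin m, v.val + 1 < k → v < c →
    K v c * K c v = if c.val = v.val + 1 then 1 else 0
  end_sum : ∀ v : Fin m, v.val + 1 = k → (∑ c, if v < c then K v c * K c v else 0) = 2
  leaf : ∀ v c : Fin m, k ≤ v.val → v < c → K v c * K c v = 0

theorem IsChain.pivot {m k : ℕ} {K : Matrix (Fin m) (Fin m) ℤ} (h : IsChain K k) (v : Fin m) :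
    RatFunc.X + 1 = chainPivot k v + ∑ c : Fin m, if v < c then
      RatFunc.X * ((K v c * K c v : ℤ) : RatFunc ℚ) / chainPivot k c else 0 := by
  rcases lt_trichotomy (v.val + 1) k with hv | hv | hv
  · rw [Finset.sum_eq_single ⟨v.val + 1, hv.trans h.lt⟩]
    · rw [if_pos (Fin.lt_def.2 (Nat.lt_succ_self _)), h.chain _ _ hv
        (Fin.lt_def.2 (Nat.lt_succ_self _)), if_pos rfl]
      simpa using chainPivot_step hv
    · intro c _ hc
      split_ifs with hvc
      · have : c.val ≠ v.val + 1 := fun h' => hc (Fin.ext h')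
        rw [h.chain _ _ hv hvc, if_neg this]
        simp
      · rfl
    · simp
  · have : ∀ c : Fin m, (if v < c then
        RatFunc.X * ((K v c * K c v : ℤ) : RatFunc ℚ) / chainPivot k c else 0) =
        RatFunc.X / (RatFunc.X + 1) *
          ((if v < c then K v c * K c v else 0 : ℤ) : RatFunc ℚ) := by
      intro c
      split_ifs with hvc
      · have : k ≤ c.val := by
          rw [Fin.lt_def] at hvc
          omega
        rw [chainPivot, if_neg (by omega)]
        ring
      · simp
    rw [Finset.sum_congr rfl fun c _ => this c, ← Finset.mul_sum, ← Int.cast_sum, h.end_sum v hv]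
    refine (chainPivot_end hv).trans ?_
    push_cast
    ring
  · rw [Finset.sum_eq_zero]
    · rw [chainPivot, if_neg (by omega), add_zero]
    · intro c _
      split_ifs with hvc
      · rw [h.leaf v c (by omega) hvc]
        simp
      · rfl

theorem IsChain.isPivots {m k : ℕ} {K : Matrix (Fin m) (Fin m) ℤ} (h : IsChain K k) :
    IsPivots K (fun v => -(v.val : ℤ)) (fun v => chainPivot k v) where
  diag := h.diag
  inj v w hvw := Fin.ext (by simpa using hvw)
  ne_zero v := chainPivot_ne_zero k v
  forest c v w hvw hv hw := h.forest c v w hvw (Fin.lt_def.2 (by omega)) (Fin.lt_def.2 (by omega))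
  pivot v := by
    simpa using h.pivot v

/-- In this form the vertices k and k + 1 are visibly two interchangeable leaves at k - 1; it serves
both the elimination and the folding. -/
theorem cartanMatrix_D_apply {k : ℕ} (hk : 2 ≤ k) (v c : Fin (k + 2)) :
    CartanMatrix.D (k + 2) v c =
      if v.val = c.val then 2
      else if (c.val = v.val + 1 ∧ c.val < k) ∨ (v.val + 1 = k ∧ k ≤ c.val) ∨
        (v.val = c.val + 1 ∧ v.val < k) ∨ (c.val + 1 = k ∧ k ≤ v.val) then -1 else 0 := by
  simp only [CartanMatrix.D, Matrix.of_apply, Fin.ext_iff] at *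
  grind

theorem cartanMatrix_D_apply_of_lt {k : ℕ} (hk : 2 ≤ k) {v c : Fin (k + 2)} (hvc : v < c) :
    CartanMatrix.D (k + 2) v c =
      if (c.val = v.val + 1 ∧ c.val < k) ∨ (v.val + 1 = k ∧ k ≤ c.val) then -1 else 0 := by
  rw [Fin.lt_def] at hvc
  rw [cartanMatrix_D_apply hk, if_neg (by omega)]
  congr 1
  rw [eq_iff_iff]
  omega

theorem isChain_D (k : ℕ) (hk : 2 ≤ k) : IsChain (CartanMatrix.D (k + 2)) k := by
  have hsymm : ∀ v c, CartanMatrix.D (k + 2) v c = CartanMatrix.D (k + 2) c v :=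
    fun v c => (CartanMatrix.D_isSymm (k + 2)).apply c v
  have hmul : ∀ v c : Fin (k + 2), v < c →
      CartanMatrix.D (k + 2) v c * CartanMatrix.D (k + 2) c v =
        if (c.val = v.val + 1 ∧ c.val < k) ∨ (v.val + 1 = k ∧ k ≤ c.val) then 1 else 0 := by
    intro v c hvc
    rw [hsymm c v, cartanMatrix_D_apply_of_lt hk hvc]
    split_ifs <;> rfl
  refine ⟨by omega, CartanMatrix.D_diag _, ?_, ?_, ?_, ?_⟩
  · intro c v w hvw hv hw
    rw [hsymm c w, cartanMatrix_D_apply_of_lt hk hv, cartanMatrix_D_apply_of_lt hk hw]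
    have hvw' : v.val ≠ w.val := fun h => hvw (Fin.ext h)
    split_ifs
    · omega
    all_goals rfl
  · intro v c hv hvc
    rw [hmul v c hvc]
    congr 1
    rw [eq_iff_iff]
    omega
  · intro v hv
    rw [Fin.sum_univ_castSucc, Fin.sum_univ_castSucc, Finset.sum_eq_zero]
    · have h1 : v < (Fin.last k).castSucc := by rw [Fin.lt_def]; simp; omega
      have h2 : v < Fin.last (k + 1) := by rw [Fin.lt_def]; simp; omega
      rw [if_pos h1, if_pos h2, hmul _ _ h1, hmul _ _ h2, if_pos (by simp; omega),
        if_pos (by simp; omega)]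
      rfl
    · intro c _
      rw [if_neg]
      rw [Fin.lt_def]
      have := c.isLt
      simp
      omega
  · intro v c hv hvc
    rw [hmul v c hvc, if_neg]
    omega

theorem isChain_C (k : ℕ) : IsChain (CartanMatrix.C (k + 1)) k where
  lt := by omega
  diag := CartanMatrix.C_diag _
  forest c v w hvw hv hw := by
    simp only [CartanMatrix.C, Matrix.of_apply, Fin.lt_def, Fin.ext_iff, ne_eq] at *
    split_ifs <;> first | rfl | omega
  chain v c hv hvc := by
    simp only [CartanMatrix.C, Matrix.of_apply, Fin.lt_def, Fin.ext_iff] at *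
    split_ifs <;> first | rfl | omega
  end_sum v hv := by
    rw [Fin.sum_univ_castSucc, Finset.sum_eq_zero]
    · simp only [CartanMatrix.C, Matrix.of_apply, Fin.lt_def, Fin.ext_iff, Fin.val_last]
      split_ifs <;> first | rfl | omega
    · intro c _
      have := c.isLt
      simp only [CartanMatrix.C, Matrix.of_apply, Fin.lt_def, Fin.ext_iff, Fin.val_castSucc]
      split_ifs <;> first | rfl | omega
  leaf v c hv hvc := by
    simp only [Fin.lt_def] at *
    omega

theorem IsChain.transpose {m k : ℕ} {K : Matrix (Fin m) (Fin m) ℤ} (h : IsChain K k) :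
    IsChain Kᵀ k where
  lt := h.lt
  diag := h.diag
  forest c v w hvw hv hw := by
    rw [Matrix.transpose_apply, Matrix.transpose_apply, mul_comm]
    exact h.forest c w v hvw.symm hw hv
  chain v c hv hvc := by
    rw [Matrix.transpose_apply, Matrix.transpose_apply, mul_comm]
    exact h.chain v c hv hvc
  end_sum v hv := by
    simp only [Matrix.transpose_apply, mul_comm (K _ v)]
    exact h.end_sum v hv
  leaf v c hv hvc := by
    rw [Matrix.transpose_apply, Matrix.transpose_apply, mul_comm]
    exact h.leaf v c hv hvc

theorem isChain_B (k : ℕ) : IsChain (CartanMatrix.B (k + 1)) k := by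
  rw [← CartanMatrix.C_transpose]
  exact (isChain_C k).transpose

/-- The pivots of a chain, when the vertex `1` is eliminated last. -/
theorem IsChain.isPivots_one {m k : ℕ} {K : Matrix (Fin m) (Fin m) ℤ} (h : IsChain K k)
    (hk : 2 ≤ k) :
    IsPivots K (fun v => if v.val = 1 then 1 else -(v.val : ℤ)) fun v =>
      if v.val = 0 then RatFunc.X + 1
      else if v.val = 1 then
        (RatFunc.X ^ (k + 1) + 1) / ((RatFunc.X ^ (k - 1) + 1) * (RatFunc.X + 1))
      else chainPivot k v where
  diag := h.diag
  inj v w hvw := by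
    ext
    change (if v.val = 1 then 1 else -(v.val : ℤ)) = if w.val = 1 then 1 else -(w.val : ℤ) at hvw
    split_ifs at hvw <;> omega
  ne_zero v := by
    split_ifs
    · exact X_add_one_ne_zero
    · exact div_ne_zero (X_pow_add_one_ne_zero _)
        (mul_ne_zero (X_pow_add_one_ne_zero _) X_add_one_ne_zero)
    · exact chainPivot_ne_zero k v
  forest c v w hvw hv hw := by
    have hvw' : v.val ≠ w.val := fun h => hvw (Fin.ext h)
    refine h.forest c v w hvw (Fin.lt_def.2 ?_) (Fin.lt_def.2 ?_) <;>
      split_ifs at hv hw <;> omega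
  pivot v := by
    have hm := h.lt
    have hX := X_add_one_ne_zero
    have hX' := X_pow_add_one_ne_zero
    obtain ⟨j, rfl⟩ : ∃ j, k = j + 2 := ⟨k - 2, by omega⟩
    have h01 : K ⟨0, by omega⟩ ⟨1, by omega⟩ * K ⟨1, by omega⟩ ⟨0, by omega⟩ = 1 :=
      h.chain ⟨0, by omega⟩ ⟨1, by omega⟩ (by simp) (Fin.lt_def.2 (by simp))
    rcases Nat.lt_trichotomy v.val 1 with hv | hv | hv
    · have hv : v.val = 0 := by omega
      simp only [hv, if_true]
      rw [Finset.sum_eq_zero, add_zero]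
      -- Only vertex 1 is joined to 0, and it is now eliminated later; so 0 acts as a leaf.
      intro c _
      by_cases hc : c.val = 0 ∨ c.val = 1
      · rw [if_neg]
        rcases hc with hc | hc <;> simp [hc]
      · have hw : K v c * K c v = 0 := by
          rw [h.chain v c (by omega) (Fin.lt_def.2 (by omega)), if_neg (by omega)]
        simp [hw]
    · obtain ⟨v, hvm⟩ := v
      obtain rfl : v = 1 := hv
      -- Compared with elimination from the far end, vertex 1 loses a further λ/(λ + 1) to vertex 0:
      -- the new pivot is `chainPivot k 1` minus this term.
      have hp := h.pivot ⟨1, by omega⟩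
      have hs : ∀ c : Fin m,
          (if (if c.val = 1 then (1 : ℤ) else -(c.val : ℤ)) < 1 then
            RatFunc.X * ((K ⟨1, by omega⟩ c * K c ⟨1, by omega⟩ : ℤ) : RatFunc ℚ) /
              (if c.val = 0 then RatFunc.X + 1
              else if c.val = 1 then (RatFunc.X ^ (j + 2 + 1) + 1) /
                ((RatFunc.X ^ (j + 2 - 1) + 1) * (RatFunc.X + 1))
              else chainPivot (j + 2) c) else 0) =
          (if (⟨1, by omega⟩ : Fin m) < c then RatFunc.X *
            ((K ⟨1, by omega⟩ c * K c ⟨1, by omega⟩ : ℤ) : RatFunc ℚ) /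
              chainPivot (j + 2) c else 0) +
          if c = ⟨0, by omega⟩ then RatFunc.X / (RatFunc.X + 1) else 0 := by
        intro c
        rcases Nat.lt_trichotomy c.val 1 with hc | hc | hc
        · obtain ⟨c, hcm⟩ := c
          obtain rfl : c = 0 := by simpa using hc
          rw [mul_comm (K _ _), h01]
          simp [Fin.lt_def]
        · simp [hc, Fin.lt_def, Fin.ext_iff]
        · have h0 : c.val ≠ 0 := by omega
          have h1 : c.val ≠ 1 := by omega
          have h2 : -(c.val : ℤ) < 1 := by omega
          simp [h0, h1, h2, hc, Fin.lt_def, Fin.ext_iff]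
      simp only [if_true, one_ne_zero, if_false]
      rw [Finset.sum_congr rfl fun c _ => hs c, Finset.sum_add_distrib, Finset.sum_ite_eq']
      simp only [Finset.mem_univ, if_true]
      rw [chainPivot, if_pos (by simp)] at hp
      refine hp.trans ?_
      rw [add_comm (Finset.sum _ _), ← add_assoc]
      congr 1
      have e1 : j + 2 + 1 - 1 = j + 2 := by omega
      have e2 : j + 2 - 1 = j + 1 := by omega
      have h3 := hX' (j + 1)
      simp only [e1, e2]
      field_simp
      ring
    · have h0 : v.val ≠ 0 := by omega
      have h1 : v.val ≠ 1 := by omega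
      simp only [h0, h1, if_false]
      refine (h.pivot v).trans ?_
      congr 1
      refine Finset.sum_congr rfl fun c _ => ?_
      by_cases hvc : v < c
      · have hvc' := Fin.lt_def.1 hvc
        have h2 : c.val ≠ 0 := by omega
        have h3 : c.val ≠ 1 := by omega
        simp [hvc, h2, h3]
      · have hvc' := mt Fin.lt_def.2 hvc
        rw [if_neg hvc, if_neg]
        split_ifs <;> omega

/-- This treats B and D at once, since in both the affine vertex is attached to vertex 1. The value
of `e` comes from (λ + 1)(λ^(k+1) + 1 - λ(λ^(k-1) + 1)) = (λ² - 1)(λ^k - 1). -/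
theorem IsChain.charRatio_extend_one {m k : ℕ} {K : Matrix (Fin m) (Fin m) ℤ} (h : IsChain K k)
    (hk : 2 ≤ k) {C : Matrix (Fin m) (Fin m) ℤ} {Ca : Matrix (Option (Fin m)) (Option (Fin m)) ℤ}
    (hC : (IsCoxeter K C ∧ IsCoxeter (extend K (fun j => if j.val = 1 then -1 else 0)
        (fun i => if i.val = 1 then -1 else 0)) Ca) ∨
      (IsCoxeter Kᵀ C ∧ IsCoxeter (extend K (fun j => if j.val = 1 then -1 else 0)
        (fun i => if i.val = 1 then -1 else 0))ᵀ Ca)) :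
    charRatio C Ca =
      (RatFunc.X ^ (k + 1) + 1) / ((RatFunc.X ^ k - 1) * (RatFunc.X ^ 2 - 1)) := by
  have hm := h.lt
  have h1 := X_pow_add_one_ne_zero (k + 1)
  have h2 : (RatFunc.X ^ k - 1 : RatFunc ℚ) ≠ 0 := X_pow_sub_one_ne_zero (by omega)
  have h3 : (RatFunc.X ^ 2 - 1 : RatFunc ℚ) ≠ 0 := X_pow_sub_one_ne_zero two_ne_zero
  have hr : ∀ v : Fin m, v ≠ ⟨1, by omega⟩ → (if v.val = 1 then (-1 : ℤ) else 0) = 0 := by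
    intro v hv
    exact if_neg fun h => hv (Fin.ext h)
  rw [(h.isPivots_one hk).charRatio_extend (u := ⟨1, by omega⟩) ?_ hr hr
    (e := ((RatFunc.X ^ k - 1) * (RatFunc.X ^ 2 - 1)) / (RatFunc.X ^ (k + 1) + 1))
    (div_ne_zero (mul_ne_zero h2 h3) h1) ?_ hC, one_div_div]
  · intro v
    simp only [if_true]
    split_ifs <;> omega
  · obtain ⟨j, rfl⟩ : ∃ j, k = j + 1 := ⟨k - 1, by omega⟩
    simp
    field_simp
    ring

theorem charRatio_D {n : ℕ} (hn : 3 ≤ n) {C : Matrix (Fin (n + 1)) (Fin (n + 1)) ℤ}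
    {Ca : Matrix (Option (Fin (n + 1))) (Option (Fin (n + 1))) ℤ}
    (hC : IsCoxeter (CartanMatrix.D (n + 1)) C) (hCa : IsCoxeter (affineD (n + 1)) Ca) :
    charRatio C Ca = (RatFunc.X ^ n + 1) / ((RatFunc.X ^ (n - 1) - 1) * (RatFunc.X ^ 2 - 1)) := by
  obtain ⟨k, rfl⟩ : ∃ k, n = k + 1 := ⟨n - 1, by omega⟩
  exact (isChain_D k (by omega)).charRatio_extend_one (by omega) (Or.inl ⟨hC, hCa⟩)

theorem charRatio_B {n : ℕ} (hn : 3 ≤ n) {C : Matrix (Fin n) (Fin n) ℤ}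
    {Ca : Matrix (Option (Fin n)) (Option (Fin n)) ℤ}
    (hC : (IsCoxeter (CartanMatrix.B n) C ∧ IsCoxeter (affineB n) Ca) ∨
      (IsCoxeter (CartanMatrix.B n)ᵀ C ∧ IsCoxeter (affineB n)ᵀ Ca)) :
    charRatio C Ca = (RatFunc.X ^ n + 1) / ((RatFunc.X ^ (n - 1) - 1) * (RatFunc.X ^ 2 - 1)) := by
  obtain ⟨k, rfl⟩ : ∃ k, n = k + 1 := ⟨n - 1, by omega⟩
  exact (isChain_B k).charRatio_extend_one (by omega) hC

/-- The chain is eliminated from its double edge to the root 0. The second double edge makes e = λ +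
1 - 2λ/d₀, and (λ + 1)(λ^n + 1) - 2λ(λ^(n-1) + 1) = (λ^n - 1)(λ - 1). -/
theorem charRatio_C {n : ℕ} (hn : 2 ≤ n) {C : Matrix (Fin n) (Fin n) ℤ}
    {Ca : Matrix (Option (Fin n)) (Option (Fin n)) ℤ}
    (hC : (IsCoxeter (CartanMatrix.C n) C ∧ IsCoxeter (affineC n) Ca) ∨
      (IsCoxeter (CartanMatrix.C n)ᵀ C ∧ IsCoxeter (affineC n)ᵀ Ca)) :
    charRatio C Ca = (RatFunc.X ^ n + 1) / ((RatFunc.X ^ n - 1) * (RatFunc.X - 1)) := by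
  obtain ⟨k, rfl⟩ : ∃ k, n = k + 1 := ⟨n - 1, by omega⟩
  have h1 := X_pow_add_one_ne_zero (k + 1)
  have h2 : (RatFunc.X ^ (k + 1) - 1 : RatFunc ℚ) ≠ 0 := X_pow_sub_one_ne_zero (by omega)
  have h3 := X_sub_one_ne_zero
  have h4 := X_pow_add_one_ne_zero k
  have h0 : ∀ (a : ℤ) (v : Fin (k + 1)), v ≠ 0 → (if v.val = 0 then a else 0) = 0 := by
    intro a v hv
    exact if_neg fun h => hv (Fin.ext h)
  rw [(isChain_C k).isPivots.charRatio_extend (u := 0) (by simp) (h0 _) (h0 _)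
    (e := ((RatFunc.X ^ (k + 1) - 1) * (RatFunc.X - 1)) / (RatFunc.X ^ (k + 1) + 1))
    (div_ne_zero (mul_ne_zero h2 h3) h1) ?_ hC, one_div_div]
  have hk : 0 < k := by omega
  simp [chainPivot, hk]
  field_simp
  ring

/-! ### Paths and even cycles -/

theorem prod_X_pow_sub_one_div (m : ℕ) :
    ∏ v ∈ Finset.range m, ((RatFunc.X ^ (m + 1 - v) - 1) / (RatFunc.X ^ (m - v) - 1) : RatFunc ℚ) =
      (RatFunc.X ^ (m + 1) - 1) / (RatFunc.X - 1) := by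
  induction m with
  | zero => simp [div_self X_sub_one_ne_zero]
  | succ m ih =>
    rw [Finset.prod_range_succ']
    simp only [Nat.add_sub_add_right, ih, Nat.sub_zero]
    have h1 := X_sub_one_ne_zero
    have h2 : (RatFunc.X ^ (m + 1) - 1 : RatFunc ℚ) ≠ 0 := X_pow_sub_one_ne_zero (by omega)
    field_simp

/-- The pivots are quotients of consecutive terms of λ^j - 1, which obeys the recursion of the
chains but starts at 0 because the path simply stops. The product telescopes. General matrices are
allowed because the path inside a cycle is needed as well as A_m. -/
theorem det_path {m : ℕ} (M : Matrix (Fin m) (Fin m) (RatFunc ℚ))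
    (hdiag : ∀ v, M v v = RatFunc.X + 1)
    (hadj : ∀ v c : Fin m, c.val = v.val + 1 → M v c * M c v = RatFunc.X)
    (hzero : ∀ v c : Fin m, v < c → c.val ≠ v.val + 1 → M v c = 0 ∧ M c v = 0) :
    M.det = (RatFunc.X ^ (m + 1) - 1) / (RatFunc.X - 1) := by
  rw [← prod_X_pow_sub_one_div, ← Fin.prod_univ_eq_prod_range]
  have h0 : ∀ k : ℕ, k < m → (RatFunc.X ^ (m - k) - 1 : RatFunc ℚ) ≠ 0 :=
    fun k hk => X_pow_sub_one_ne_zero (by omega)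
  have h0' : ∀ k : ℕ, k < m → (RatFunc.X ^ (m + 1 - k) - 1 : RatFunc ℚ) ≠ 0 :=
    fun k hk => X_pow_sub_one_ne_zero (by omega)
  refine det_eq_prod_of_forest M (fun v => -(v.val : ℤ)) (fun v w hvw => Fin.ext (by simpa using hvw))
    _ (fun v => div_ne_zero (h0' v v.isLt) (h0 v v.isLt)) ?_ ?_
  · intro c v w hvw hv hw
    have hv : v < c := Fin.lt_def.2 (by omega)
    have hw : w < c := Fin.lt_def.2 (by omega)
    have hvw' : v.val ≠ w.val := fun h => hvw (Fin.ext h)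
    by_cases hvc : c.val = v.val + 1
    · rw [(hzero w c hw (by omega)).2, mul_zero]
    · rw [(hzero v c hv hvc).1, zero_mul]
  · intro v
    have hX := X_sub_one_ne_zero
    rw [hdiag]
    by_cases hv : v.val + 1 < m
    · obtain ⟨j, hj⟩ : ∃ j, m = v.val + j + 2 := ⟨m - v.val - 2, by omega⟩
      rw [Finset.sum_eq_single ⟨v.val + 1, hv⟩]
      · have h1 := h0 _ hv
        have h2 := h0 _ v.isLt
        rw [if_pos (by simp), hadj v ⟨v.val + 1, hv⟩ rfl]
        have e1 : m + 1 - v.val = j + 3 := by omega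
        have e2 : m - v.val = j + 2 := by omega
        have e3 : m - (v.val + 1) = j + 1 := by omega
        have e4 : m + 1 - (v.val + 1) = j + 2 := by omega
        simp only [e2, e3] at h1 h2
        simp only [e1, e2, e3, e4]
        field_simp
        ring
      · intro c _ hc
        split_ifs with hvc
        · have : c.val ≠ v.val + 1 := fun h' => hc (Fin.ext h')
          rw [(hzero v c (Fin.lt_def.2 (by omega)) this).1]
          simp
        · rfl
      · simp
    · rw [Finset.sum_eq_zero]
      · have e1 : m + 1 - v.val = 2 := by omega
        have e2 : m - v.val = 1 := by omega
        rw [e1, e2, pow_one]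
        field_simp
        ring
      · intro c _
        rw [if_neg]
        omega

/-- A Schur complement without inverting the block: adding the columns with weights `v` to column
`none` turns it into δ times a unit vector. -/
theorem det_option_of_mulVec {n : ℕ} {F : Type*} [Field F]
    (M : Matrix (Option (Fin n)) (Option (Fin n)) F) (v : Fin n → F) (δ : F)
    (hnone : M none none + ∑ j, M none (some j) * v j = δ)
    (hsome : ∀ i, M (some i) none + ∑ j, M (some i) (some j) * v j = 0) :
    M.det = δ * (M.submatrix some some).det := by
  let N : Matrix (Option (Fin n)) (Option (Fin n)) F := Matrix.of fun i j =>
    match i, j with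
    | none, none => 1
    | none, some _ => 0
    | some i, none => v i
    | some i, some j => if i = j then 1 else 0
  have hN : N.det = 1 := by
    refine det_eq_one_of_upper N (fun i => i.elim (n : ℤ) fun i => (i.val : ℤ)) ?_ ?_ ?_
    · rintro (_ | i) (_ | j) hij
      · rfl
      · have : (n : ℤ) = j.val := hij
        omega
      · have : (i.val : ℤ) = n := hij
        omega
      · have : (i.val : ℤ) = j.val := hij
        exact congrArg some (Fin.ext (by omega))
    · rintro (_ | i) <;> simp [N]
    · rintro (_ | i) (_ | j) hij
      · exact absurd hij (lt_irrefl _)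
      · rfl
      · have : (n : ℤ) < i.val := hij
        omega
      · have : (j.val : ℤ) < i.val := hij
        have : i ≠ j := by rintro rfl; omega
        simp [N, this]
  rw [← mul_one M.det, ← hN, ← Matrix.det_mul,
    ← Matrix.det_reindex_self (Equiv.optionEquivSumPUnit.{0} (Fin n))]
  have : Matrix.reindex (Equiv.optionEquivSumPUnit.{0} (Fin n)) (Equiv.optionEquivSumPUnit.{0} (Fin n))
      (M * N) = Matrix.fromBlocks (M.submatrix some some) 0
        (Matrix.of fun _ j => M none (some j)) (Matrix.of fun _ _ => δ) := by
    ext (i | i) (j | j)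
    · simp [Matrix.mul_apply, Fintype.sum_option, N]
    · simpa [Matrix.mul_apply, Fintype.sum_option, N] using hsome i
    · simp [Matrix.mul_apply, Fintype.sum_option, N]
    · simpa [Matrix.mul_apply, Fintype.sum_option, N] using hnone
  rw [this, Matrix.det_fromBlocks_zero₁₂, mul_comm]
  simp

/-- Every edge joins the two colours and all of `l₁` comes first, so whether λ appears depends on
the row alone. -/
theorem coxeterMatrix_append {V : Type*} [DecidableEq V] (K : Matrix V V ℤ)
    (l₁ l₂ : List V) (hmem : ∀ v, v ∈ l₁ ++ l₂) (h₁ : ∀ i ∈ l₁, ∀ j ∈ l₁, i ≠ j → K i j = 0)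
    (h₂ : ∀ i ∈ l₂, ∀ j ∈ l₂, i ≠ j → K i j = 0) {i j : V} (hij : i ≠ j) :
    coxeterMatrix K (l₁ ++ l₂) i j = (if i ∈ l₁ then RatFunc.X else 1) * (K i j : RatFunc ℚ) := by
  simp only [coxeterMatrix, Matrix.of_apply, hij, if_false]
  by_cases hK : K i j = 0
  · simp [hK]
  congr 1
  have hi := List.mem_append.1 (hmem i)
  have hj := List.mem_append.1 (hmem j)
  by_cases hi1 : i ∈ l₁
  · have hj1 : j ∉ l₁ := fun h => hK (h₁ i hi1 j h hij)
    rw [List.idxOf_append_of_mem hi1, List.idxOf_append_of_notMem hj1, if_pos hi1, if_pos]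
    exact (List.idxOf_lt_length_iff.2 hi1).trans_le (Nat.le_add_right _ _)
  · have hj1 : j ∈ l₁ := by
      by_contra hj1
      exact hK (h₂ i (hi.resolve_left hi1) j (hj.resolve_left hj1) hij)
    rw [List.idxOf_append_of_mem hj1, List.idxOf_append_of_notMem hi1, if_neg hi1, if_neg]
    have := List.idxOf_lt_length_iff.2 hj1
    omega

theorem charRat_A {m : ℕ} {C : Matrix (Fin m) (Fin m) ℤ} (hC : IsCoxeter (CartanMatrix.A m) C) :
    charRat C = (RatFunc.X ^ (m + 1) - 1) / (RatFunc.X - 1) := by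
  obtain ⟨l, hl, hmem, rfl⟩ := hC
  rw [charRat_eq_det _ (fun i => by simp [CartanMatrix.A]) l hl hmem]
  refine det_path _ (fun v => by simp [coxeterMatrix]) ?_ ?_
  · intro v c hvc
    have : v ≠ c := by rintro rfl; omega
    rw [coxeterMatrix_mul_coxeterMatrix _ l hmem this]
    simp [CartanMatrix.A, this, this.symm, hvc]
  · intro v c hvc hc
    have h1 : v ≠ c := hvc.ne
    have h2 : v.val + 1 ≠ c.val := fun h => hc h.symm
    have h3 : c.val + 1 ≠ v.val := by rw [Fin.lt_def] at hvc; omega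
    simp [coxeterMatrix, CartanMatrix.A, h1, h1.symm, h2, h3]

/-- The solution of the linear recursion that eliminates the path from an even cycle. -/
noncomputable def cycleVec (n : ℕ) (e : RatFunc ℚ) (p : ℕ) : RatFunc ℚ :=
  if Even p then (RatFunc.X ^ (p / 2) + RatFunc.X ^ (n - p / 2)) / (RatFunc.X ^ n + 1)
  else (RatFunc.X ^ (p / 2 + 1) + RatFunc.X ^ (n - p / 2)) / (RatFunc.X ^ n + 1) / e

theorem cycleVec_even (n i : ℕ) (e : RatFunc ℚ) : cycleVec n e (2 * i) =
    (RatFunc.X ^ i + RatFunc.X ^ (n - i)) / (RatFunc.X ^ n + 1) := by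
  simp [cycleVec]

theorem cycleVec_odd (n i : ℕ) (e : RatFunc ℚ) : cycleVec n e (2 * i + 1) =
    (RatFunc.X ^ (i + 1) + RatFunc.X ^ (n - i)) / (RatFunc.X ^ n + 1) / e := by
  have h : ¬ Even (2 * i + 1) := by simp
  rw [cycleVec, if_neg h]
  have : (2 * i + 1) / 2 = i := by omega
  rw [this]

/-- With μ² = λ, `cycleVec` is z_p = μ^p + μ^(2n-p) divided by λ^n + 1, with an extra factor μ/e at
odd p. The identity (μ² + 1) z_{p+1} = μ(z_p + z_{p+2}) becomes a recursion with coefficients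
alternating between λ/e and e. -/
theorem cycleVec_rec {n : ℕ} {e : RatFunc ℚ} (he : e ≠ 0) {p : ℕ} (hp : p + 1 < 2 * n) :
    (RatFunc.X + 1) * cycleVec n e (p + 1) =
      (if Even p then RatFunc.X / e else e) * (cycleVec n e p + cycleVec n e (p + 2)) := by
  have h := X_pow_add_one_ne_zero n
  rcases Nat.even_or_odd' p with ⟨i, rfl | rfl⟩
  · have h2 : 2 * i + 2 = 2 * (i + 1) := by ring
    rw [if_pos (by simp), h2, cycleVec_even, cycleVec_odd, cycleVec_even]
    obtain ⟨j, rfl⟩ : ∃ j, n = i + j + 1 := ⟨n - i - 1, by omega⟩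
    have e1 : i + j + 1 - i = j + 1 := by omega
    have e2 : i + j + 1 - (i + 1) = j := by omega
    rw [e1, e2]
    field_simp
    ring
  · have h2 : 2 * i + 1 + 2 = 2 * (i + 1) + 1 := by ring
    have h3 : 2 * i + 1 + 1 = 2 * (i + 1) := by ring
    have h4 : ¬ Even (2 * i + 1) := by simp
    rw [if_neg h4, h2, h3, cycleVec_even, cycleVec_odd, cycleVec_odd]
    obtain ⟨j, rfl⟩ : ∃ j, n = i + j + 1 := ⟨n - i - 1, by omega⟩
    have e1 : i + j + 1 - i = j + 1 := by omega
    have e2 : i + j + 1 - (i + 1) = j := by omega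
    rw [e1, e2]
    field_simp
    ring

/-- Vertex j of the path sits at position j + 1 of the cycle; positions 0 and m + 1 both stand for
the removed vertex. Their terms are missing here and come from the column of that vertex. -/
theorem sum_path {R : Type*} [CommRing R] {m : ℕ} (i : Fin m) (a b : R) (y : ℕ → R) :
    (∑ j : Fin m, (if i = j then a
      else if i.val + 1 = j.val ∨ j.val + 1 = i.val then b else 0) * y (j.val + 1)) =
      a * y (i.val + 1) + (if i.val = 0 then 0 else b * y i.val) +
        if i.val + 1 = m then 0 else b * y (i.val + 2) := by
  have hi := i.isLt
  -- For i = 0 the index `i.val - 1` truncates to 0, and the inner condition cancels the spurious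
  -- term.
  have h : ∀ j : Fin m, (if i = j then a
      else if i.val + 1 = j.val ∨ j.val + 1 = i.val then b else 0) * y (j.val + 1) =
      (if j.val = i.val then a * y (i.val + 1) else 0) +
        (if j.val = i.val - 1 then (if i.val = 0 then 0 else b * y i.val) else 0) +
        (if j.val = i.val + 1 then b * y (i.val + 2) else 0) := by
    intro j
    rcases lt_trichotomy j.val i.val with hj | hj | hj
    · have h1 : i ≠ j := by rintro rfl; omega
      have h2 : ¬ i.val + 1 = j.val := by omega
      have h3 : ¬ j.val = i.val := by omega
      have h4 : ¬ j.val = i.val + 1 := by omega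
      have h5 : ¬ i.val = 0 := by omega
      by_cases h6 : j.val + 1 = i.val
      · have h7 : j.val = i.val - 1 := by omega
        simp only [h1, h2, h3, h4, h5, h6, if_false, or_true, if_true, add_zero, zero_add]
        rw [if_pos h7]
      · have h7 : ¬ j.val = i.val - 1 := by omega
        simp [h1, h2, h3, h4, h6, h7]
    · obtain rfl : j = i := Fin.ext hj
      by_cases h0 : j.val = 0
      · simp [h0]
      · have : ¬ j.val = j.val - 1 := by omega
        simp [this]
    · have h1 : i ≠ j := by rintro rfl; omega
      have h2 : ¬ j.val + 1 = i.val := by omega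
      have h3 : ¬ j.val = i.val := by omega
      have h4 : ¬ j.val = i.val - 1 := by omega
      by_cases h6 : j.val = i.val + 1
      · simp [h1, h6]
        intro h
        omega
      · have h7 : ¬ i.val + 1 = j.val := by omega
        simp [h1, h2, h3, h4, h6, h7]
  rw [Finset.sum_congr rfl fun j _ => h j, Finset.sum_add_distrib, Finset.sum_add_distrib,
    Fin.sum_univ_eq_sum_range (fun j => if j = i.val then a * y (i.val + 1) else 0),
    Fin.sum_univ_eq_sum_range
      (fun j => if j = i.val - 1 then (if i.val = 0 then 0 else b * y i.val) else 0),
    Fin.sum_univ_eq_sum_range (fun j => if j = i.val + 1 then b * y (i.val + 2) else 0)]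
  simp only [Finset.sum_ite_eq', Finset.mem_range]
  have h1 : i.val - 1 < m := by omega
  rw [if_pos hi, if_pos h1]
  congr 1
  split_ifs <;> first | rfl | omega

/-- The determinant is that of the path, (λ^(2n) - 1)/(λ - 1), times the Schur complement (λ -
1)(λ^n - 1)/(λ^n + 1). On a cycle the determinant also involves the products around the cycle, so
the bicolored order matters. -/
theorem charRat_affineA {n : ℕ} (hn : 2 ≤ n)
    {C : Matrix (Option (Fin (2 * n - 1))) (Option (Fin (2 * n - 1))) ℤ}
    (hC : IsBicoloredCoxeter (affineA (2 * n - 1)) C) :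
    charRat C = (RatFunc.X ^ n - 1) ^ 2 := by
  obtain ⟨l₁, l₂, hl, hmem, h₁, h₂, rfl⟩ := hC
  have hdiag : ∀ i, affineA (2 * n - 1) i i = 2 := by
    rintro (_ | i)
    · rfl
    · simp [affineA, extend, CartanMatrix.A]
  rw [← List.prod_append, ← List.map_append, charRat_eq_det _ hdiag _ hl hmem]
  set M := coxeterMatrix (affineA (2 * n - 1)) (l₁ ++ l₂) with hM
  let e : Option (Fin (2 * n - 1)) → RatFunc ℚ := fun i => if i ∈ l₁ then RatFunc.X else 1
  have hMe : ∀ i j, i ≠ j → M i j = e i * (affineA (2 * n - 1) i j : RatFunc ℚ) :=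
    fun i j hij => by convert coxeterMatrix_append _ l₁ l₂ hmem h₁ h₂ hij
  have hMd : ∀ i, M i i = RatFunc.X + 1 := fun i => by simp [hM, coxeterMatrix]
  have hee : ∀ i j, i ≠ j → affineA (2 * n - 1) i j ≠ 0 → e i * e j = RatFunc.X := by
    intro i j hij hK
    have hi := List.mem_append.1 (hmem i)
    have hj := List.mem_append.1 (hmem j)
    by_cases hi1 : i ∈ l₁ <;> by_cases hj1 : j ∈ l₁
    · exact absurd (h₁ i hi1 j hj1 hij) hK
    · simp [e, hi1, hj1]
    · simp [e, hi1, hj1]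
    · exact absurd (h₂ i (hi.resolve_left hi1) j (hj.resolve_left hj1) hij) hK
  have hne : ∀ i, e i ≠ 0 := by
    intro i
    simp only [e]
    split_ifs
    · exact RatFunc.X_ne_zero
    · exact one_ne_zero
  have hadj : ∀ v c : Fin (2 * n - 1), c.val = v.val + 1 →
      affineA (2 * n - 1) (some v) (some c) = -1 ∧
        affineA (2 * n - 1) (some c) (some v) = -1 := by
    intro v c hvc
    have : v ≠ c := by rintro rfl; omega
    simp [affineA, extend, CartanMatrix.A, this, this.symm, hvc]
  -- The colours alternate along the path, and the row factors of two neighbours multiply to λ.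
  have hs : ∀ i : Fin (2 * n - 1), e (some i) =
      if Even i.val then RatFunc.X / e none else e none := by
    rintro ⟨i, hi⟩
    induction i with
    | zero =>
      have := hee none (some ⟨0, hi⟩) (by simp) (by simp [affineA, extend])
      have h0 := hne none
      simp
      field_simp
      rw [mul_comm]
      exact this
    | succ i ih =>
      have hi' : i < 2 * n - 1 := by omega
      have h1 := hee (some ⟨i, hi'⟩) (some ⟨i + 1, hi⟩) (by simp)
        (by rw [(hadj ⟨i, hi'⟩ ⟨i + 1, hi⟩ rfl).1]; simp)
      have h0 := hne none
      have hX : (RatFunc.X : RatFunc ℚ) ≠ 0 := RatFunc.X_ne_zero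
      rw [ih hi'] at h1
      by_cases hev : Even i
      · have hod : ¬ Even (i + 1) := by simpa [Nat.even_add_one] using hev
        simp only [hev, hod, if_true, if_false] at h1 ⊢
        field_simp at h1
        exact h1
      · have hod : Even (i + 1) := by simpa [Nat.even_add_one] using hev
        simp only [hev, hod, if_true, if_false] at h1 ⊢
        field_simp
        rw [mul_comm]
        exact h1
  have hpath : (M.submatrix some some).det =
      (RatFunc.X ^ (2 * n - 1 + 1) - 1) / (RatFunc.X - 1) := by
    refine det_path _ (fun v => hMd (some v)) ?_ ?_
    · intro v c hvc
      have hne' : some v ≠ some c := by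
        intro h
        obtain rfl := Option.some.inj h
        omega
      rw [Matrix.submatrix_apply, Matrix.submatrix_apply, hMe _ _ hne', hMe _ _ hne'.symm,
        (hadj v c hvc).1, (hadj v c hvc).2, ← hee _ _ hne' (by rw [(hadj v c hvc).1]; simp)]
      push_cast
      ring
    · intro v c hvc hc
      have hne' : v ≠ c := hvc.ne
      have h2 : v.val + 1 ≠ c.val := fun h => hc h.symm
      have h3 : c.val + 1 ≠ v.val := by rw [Fin.lt_def] at hvc; omega
      simp [hMe, affineA, extend, CartanMatrix.A, hne', hne'.symm, h2, h3]
  have hX1 := X_sub_one_ne_zero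
  have hXn := X_pow_add_one_ne_zero n
  have h0 := hne none
  -- Positions 0 and 2n are the removed vertex, whose coefficient in the combination of columns is
  -- 1.
  have hx0 : cycleVec n (e none) 0 = 1 := by
    have := cycleVec_even n 0 (e none)
    rw [mul_zero] at this
    rw [this, pow_zero, Nat.sub_zero, add_comm, div_self hXn]
  have hxn : cycleVec n (e none) (2 * n) = 1 := by
    rw [cycleVec_even, Nat.sub_self, pow_zero, div_self hXn]
  rw [det_option_of_mulVec M (fun j => cycleVec n (e none) (j.val + 1))
    ((RatFunc.X - 1) * (RatFunc.X ^ n - 1) / (RatFunc.X ^ n + 1)) ?_ ?_, hpath]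
  · have : 2 * n - 1 + 1 = n + n := by omega
    rw [this]
    field_simp
    ring
  -- Both neighbours of the removed vertex have the value (λ + λ^n)/(λ^n + 1)/e, so δ = λ + 1 - 2(λ
  -- + λ^n)/(λ^n + 1).
  · have hx1 := cycleVec_odd n 0 (e none)
    have hx2 := cycleVec_odd n (n - 1) (e none)
    have e1 : n - (n - 1) = 1 := by omega
    have e2 : n - 1 + 1 = n := by omega
    have e3 : 2 * (n - 1) + 1 = 2 * n - 1 := by omega
    rw [e1, e2, e3] at hx2
    simp only [mul_zero, zero_add, Nat.sub_zero] at hx1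
    have hsum : ∀ j : Fin (2 * n - 1), M none (some j) * cycleVec n (e none) (j.val + 1) =
        (if j.val = 0 then -e none * cycleVec n (e none) 1 else 0) +
          if j.val = 2 * n - 2 then -e none * cycleVec n (e none) (2 * n - 1) else 0 := by
      intro j
      rw [hMe _ _ (by simp)]
      by_cases hj : j.val = 0
      · have : 0 ≠ 2 * n - 2 := by omega
        simp [affineA, extend, hj, this]
      · by_cases hj' : j.val = 2 * n - 2
        · have h3 : 2 * n - 2 + 1 = 2 * n - 1 := by omega
          have h4 : 2 * n - 2 ≠ 0 := by omega
          simp [affineA, extend, hj', h3, h4]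
        · have h3 : j.val + 1 ≠ 2 * n - 1 := by omega
          simp [affineA, extend, hj, hj', h3]
    rw [Finset.sum_congr rfl fun j _ => hsum j, Finset.sum_add_distrib,
      Fin.sum_univ_eq_sum_range (fun j => if j = 0 then -e none * cycleVec n (e none) 1 else 0),
      Fin.sum_univ_eq_sum_range
        (fun j => if j = 2 * n - 2 then -e none * cycleVec n (e none) (2 * n - 1) else 0)]
    have h3 : 0 < 2 * n - 1 := by omega
    have h4 : 2 * n - 2 < 2 * n - 1 := by omega
    simp only [Finset.sum_ite_eq', Finset.mem_range, h3, h4, if_true]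
    rw [hMd, hx1, hx2]
    field_simp
    ring
  · intro i
    have hi := i.isLt
    have hsum : ∀ j : Fin (2 * n - 1), M (some i) (some j) * cycleVec n (e none) (j.val + 1) =
        (if i = j then RatFunc.X + 1 else if i.val + 1 = j.val ∨ j.val + 1 = i.val then
          -e (some i) else 0) * cycleVec n (e none) (j.val + 1) := by
      intro j
      congr 1
      by_cases hij : i = j
      · subst hij
        simp [hMd]
      · have hij' : some i ≠ some j := fun h => hij (Option.some.inj h)
        rw [hMe _ _ hij', if_neg hij]
        split_ifs with h <;> simp [affineA, extend, CartanMatrix.A, hij, h]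
    rw [Finset.sum_congr rfl fun j _ => hsum j, sum_path i _ _ (cycleVec n (e none)),
      hMe _ _ (by simp), cycleVec_rec h0 (by omega), ← hs]
    by_cases h5 : i.val = 0
    · have h6 : ¬ 0 + 1 = 2 * n - 1 := by omega
      simp only [affineA, extend, Matrix.of_apply, h5, true_or, if_true, h6, if_false, hx0]
      push_cast
      ring
    · by_cases h6 : i.val + 1 = 2 * n - 1
      · have h7 : i.val + 2 = 2 * n := by omega
        simp only [affineA, extend, Matrix.of_apply, h5, h6, h7, or_true, if_true, if_false, hxn]
        push_cast
        ring
      · simp only [affineA, extend, Matrix.of_apply, h5, h6, or_false, if_false]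
        push_cast
        ring

theorem charRatio_A {n : ℕ} (hn : 2 ≤ n) {C : Matrix (Fin (2 * n - 1)) (Fin (2 * n - 1)) ℤ}
    {Ca : Matrix (Option (Fin (2 * n - 1))) (Option (Fin (2 * n - 1))) ℤ}
    (hC : IsCoxeter (CartanMatrix.A (2 * n - 1)) C)
    (hCa : IsBicoloredCoxeter (affineA (2 * n - 1)) Ca) :
    charRatio C Ca = (RatFunc.X ^ n + 1) / ((RatFunc.X ^ n - 1) * (RatFunc.X - 1)) := by
  have h1 := X_sub_one_ne_zero
  have h2 : (RatFunc.X ^ n - 1 : RatFunc ℚ) ≠ 0 := X_pow_sub_one_ne_zero (by omega)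
  rw [charRatio, charRat_A hC, charRat_affineA hn hCa]
  have : 2 * n - 1 + 1 = n + n := by omega
  rw [this]
  field_simp
  ring

/-! ### Foldings -/

theorem optionCongr_zpow {α : Type*} (τ : Equiv.Perm α) (k : ℤ) :
    (Equiv.optionCongr τ : Equiv.Perm (Option α)) ^ k = Equiv.optionCongr (τ ^ k) := by
  let φ : Equiv.Perm α →* Equiv.Perm (Option α) :=
    { toFun := fun σ => Equiv.optionCongr σ
      map_one' := by ext x : 1; cases x <;> rfl
      map_mul' := fun σ ρ => by ext x : 1; cases x <;> rfl }
  exact (map_zpow φ τ k).symm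

/-- Columns are summed over orbits while rows are merely identified. So the new row must be summed,
whereas the new column need only be constant on orbits. -/
theorem IsFolding.extend {V W : Type*} [Fintype V] [DecidableEq V] [Fintype W] [DecidableEq W]
    {K : Matrix V V ℤ} {τ : Equiv.Perm V} {p : V → W} {L : Matrix W W ℤ}
    (h : IsFolding K τ p L) {r c : V → ℤ} {r' c' : W → ℤ} (hr : ∀ i, r (τ i) = r i)
    (hc : ∀ i, c (τ i) = c i) (hr' : ∀ w, r' w = ∑ j : V with p j = w, r j)
    (hc' : ∀ i, c' (p i) = c i) :
    IsFolding (extend K r c) (Equiv.optionCongr τ) (Option.map p) (extend L r' c') := by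
  obtain ⟨h1, h2, h3, h4⟩ := h
  refine ⟨?_, ?_, ?_, ?_⟩
  · rintro (_ | i) (_ | j)
    · rfl
    · exact hr j
    · exact hc i
    · exact h1 i j
  · rintro (_ | w)
    · exact ⟨none, rfl⟩
    · obtain ⟨i, rfl⟩ := h2 w
      exact ⟨some i, rfl⟩
  · rintro (_ | i) (_ | j)
    · simp [Equiv.Perm.SameCycle.refl]
    · simp [Equiv.Perm.SameCycle, optionCongr_zpow]
    · simp [Equiv.Perm.SameCycle, optionCongr_zpow]
    · simp [Equiv.Perm.SameCycle, optionCongr_zpow, h3]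
  · rintro (_ | i) (_ | w)
    · simp [Finset.sum_filter, CoxeterFolding.extend]
    · simp [Finset.sum_filter, CoxeterFolding.extend, hr']
    · simp [Finset.sum_filter, CoxeterFolding.extend, hc']
    · simp [Finset.sum_filter, CoxeterFolding.extend, h4]

theorem sameCycle_iff_of_involutive {V : Type*} {τ : Equiv.Perm V} (hτ : ∀ i, τ (τ i) = i)
    (i j : V) : τ.SameCycle i j ↔ i = j ∨ τ i = j := by
  constructor
  · rintro ⟨k, rfl⟩
    have h2 : τ ^ (2 : ℤ) = 1 := by
      ext x
      exact hτ x
    rcases Int.even_or_odd' k with ⟨m, rfl | rfl⟩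
    · left
      simp [_root_.zpow_mul, h2]
    · right
      simp [_root_.zpow_add, _root_.zpow_mul, h2]
  · rintro (rfl | rfl)
    · exact Equiv.Perm.SameCycle.refl _ _
    · exact ⟨1, by simp⟩

theorem apply_eq_of_sameCycle {V W : Type*} {τ : Equiv.Perm V} {p : V → W}
    (hp : ∀ i, p (τ i) = p i) {i j : V} (h : τ.SameCycle i j) : p i = p j := by
  obtain ⟨k, rfl⟩ := h
  induction k with
  | zero => rfl
  | succ k ih => rw [add_comm, _root_.zpow_one_add, Equiv.Perm.mul_apply, hp, ih]
  | pred k ih =>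
    rw [ih, ← hp ((τ ^ (-(k : ℤ) - 1)) i), ← Equiv.Perm.mul_apply, ← _root_.zpow_one_add]
    congr 3
    ring

theorem exists_folding_D₄_G₂ : ∃ τ p, IsFolding (CartanMatrix.D 4) τ p CartanMatrix.G₂ ∧
    IsFolding (affineD 4) (Equiv.optionCongr τ) (Option.map p) affineG₂ := by
  -- Triality: the rotation of the leaves 0, 2, 3 about the centre 1, which becomes vertex 0 of G₂.
  let τ : Equiv.Perm (Fin 4) := ⟨![2, 1, 3, 0], ![3, 1, 0, 2], by decide, by decide⟩
  have h : IsFolding (CartanMatrix.D 4) τ ![1, 0, 1, 1] CartanMatrix.G₂ := by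
    refine ⟨fun i => by fin_cases i <;> decide, by decide,
      fun i j => ⟨fun hij => ?_, apply_eq_of_sameCycle (by decide)⟩, by decide⟩
    have h3 : ∀ i j : Fin 4, (![1, 0, 1, 1] : Fin 4 → Fin 2) i =
        (![1, 0, 1, 1] : Fin 4 → Fin 2) j → i = j ∨ τ i = j ∨ τ (τ i) = j := by decide
    rcases h3 i j hij with rfl | rfl | rfl
    · exact Equiv.Perm.SameCycle.refl _ _
    · exact ⟨1, by simp⟩
    · exact ⟨2, rfl⟩
  refine ⟨_, _, h, ?_⟩
  unfold affineD affineG₂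
  exact h.extend (by decide) (by decide) (by decide) (by decide)

theorem exists_folding_E₆_F₄ : ∃ τ p, IsFolding CartanMatrix.E₆ τ p CartanMatrix.F₄ ∧
    IsFolding affineE₆ (Equiv.optionCongr τ) (Option.map p) affineF₄ := by
  -- The flip exchanging the branches 0, 2 and 5, 4 and fixing 1 and 3.
  let τ : Equiv.Perm (Fin 6) := ⟨![5, 1, 4, 3, 2, 0], ![5, 1, 4, 3, 2, 0], by decide, by decide⟩
  have h : IsFolding CartanMatrix.E₆ τ ![3, 0, 2, 1, 2, 3] CartanMatrix.F₄ := by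
    refine ⟨fun i => by fin_cases i <;> decide, by decide, fun i j => ?_, by decide⟩
    rw [sameCycle_iff_of_involutive (by decide)]
    revert i j
    decide
  refine ⟨_, _, h, ?_⟩
  unfold affineE₆ affineF₄
  exact h.extend (by decide) (by decide) (by decide) (by decide)

theorem exists_folding_D_B {n : ℕ} (hn : 3 ≤ n) :
    ∃ τ p, IsFolding (CartanMatrix.D (n + 1)) τ p (CartanMatrix.B n) ∧
      IsFolding (affineD (n + 1)) (Equiv.optionCongr τ) (Option.map p) (affineB n) := by
  obtain ⟨k, rfl⟩ : ∃ k, n = k + 1 := ⟨n - 1, by omega⟩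
  -- The two leaves of the fork are exchanged, and `p` sends both to the last vertex of B.
  let τ : Equiv.Perm (Fin (k + 1 + 1)) := Equiv.swap (Fin.last k).castSucc (Fin.last (k + 1))
  let p : Fin (k + 1 + 1) → Fin (k + 1) := Fin.lastCases (Fin.last k) id
  have hp : ∀ i : Fin (k + 1), p i.castSucc = i := fun i => by simp [p]
  have hpl : p (Fin.last (k + 1)) = Fin.last k := by simp [p]
  have hpv : ∀ i, (p i).val = min i.val k := by
    intro i
    induction i using Fin.lastCases with
    | last => simp [hpl]
    | cast i =>
      rw [hp]
      have := i.isLt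
      simp
      omega
  have hτv : ∀ i, (τ i).val = if i.val = k then k + 1 else if i.val = k + 1 then k else i.val := by
    intro i
    simp only [τ, Equiv.swap_apply_def, Fin.ext_iff, Fin.val_castSucc, Fin.val_last]
    split_ifs <;> simp
  have hsum : ∀ (F : Fin (k + 1 + 1) → ℤ) (w : Fin (k + 1)), ∑ j with p j = w, F j =
      F w.castSucc + if w = Fin.last k then F (Fin.last (k + 1)) else 0 := by
    intro F w
    rw [Finset.sum_filter, Fin.sum_univ_castSucc]
    simp only [hp, hpl, Finset.sum_ite_eq', Finset.mem_univ, if_true, eq_comm (a := Fin.last k)]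
  have hττ : ∀ i, τ (τ i) = i := fun i => Equiv.swap_apply_self _ _ _
  clear_value τ p
  have h : IsFolding (CartanMatrix.D (k + 1 + 1)) τ p (CartanMatrix.B (k + 1)) := by
    refine ⟨?_, ?_, ?_, ?_⟩
    · intro i j
      have hi := i.isLt
      have hj := j.isLt
      have hτi := hτv i
      have hτj := hτv j
      rw [cartanMatrix_D_apply (by omega), cartanMatrix_D_apply (by omega)]
      generalize (τ i).val = a, (τ j).val = b, i.val = i, j.val = j at *
      clear hsum hp hpl hpv hτv hττ
      have h1 : a = b ↔ i = j := by
        split_ifs at hτi hτj <;> omega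
      have h2 : ((b = a + 1 ∧ b < k) ∨ (a + 1 = k ∧ k ≤ b) ∨ (a = b + 1 ∧ a < k) ∨
          (b + 1 = k ∧ k ≤ a)) ↔ ((j = i + 1 ∧ j < k) ∨ (i + 1 = k ∧ k ≤ j) ∨
          (i = j + 1 ∧ i < k) ∨ (j + 1 = k ∧ k ≤ i)) := by
        split_ifs at hτi hτj <;> omega
      simp only [h1, h2]
    · exact fun i => ⟨i.castSucc, hp i⟩
    · intro i j
      rw [sameCycle_iff_of_involutive hττ]
      simp only [Fin.ext_iff, hpv, hτv]
      have hi := i.isLt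
      have hj := j.isLt
      split_ifs <;> omega
    · intro i w
      have hi := i.isLt
      have hw := w.isLt
      rw [hsum]
      rw [cartanMatrix_D_apply (by omega), cartanMatrix_D_apply (by omega)]
      simp only [CartanMatrix.B, Matrix.of_apply, Fin.ext_iff, hpv, Fin.val_castSucc, Fin.val_last]
      obtain ⟨i, hi'⟩ := i
      obtain ⟨w, hw'⟩ := w
      clear hsum hp hpl hpv hτv hττ
      dsimp only at *
      by_cases hwk : w = k
      · rw [if_pos hwk]
        subst hwk
        rcases le_or_gt w i with h | h
        · rw [min_eq_right h]
          split_ifs <;> first | rfl | omega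
        · rw [min_eq_left h.le]
          split_ifs <;> first | rfl | omega
      · rw [if_neg hwk, add_zero]
        rcases le_or_gt k i with h | h
        · rw [min_eq_right h]
          split_ifs <;> first | rfl | omega
        · rw [min_eq_left h.le]
          split_ifs <;> first | rfl | omega
  refine ⟨τ, p, h, h.extend ?_ ?_ ?_ ?_⟩
  · intro i
    simp only [hτv]
    grind
  · intro i
    simp only [hτv]
    grind
  · intro w
    rw [hsum]
    simp only [Fin.ext_iff, Fin.val_castSucc, Fin.val_last]
    grind
  · intro i
    simp only [hpv]
    grind

theorem exists_folding_A_C {n : ℕ} (hn : 2 ≤ n) :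
    ∃ τ p, IsFolding (CartanMatrix.A (2 * n - 1)) τ p (CartanMatrix.C n) ∧
      IsFolding (affineA (2 * n - 1)) (Equiv.optionCongr τ) (Option.map p) (affineC n) := by
  let τ : Equiv.Perm (Fin (2 * n - 1)) := Fin.revPerm
  let p : Fin (2 * n - 1) → Fin n := fun i => ⟨min i.val (2 * n - 2 - i.val), by omega⟩
  have hτv : ∀ i, (τ i).val = 2 * n - 2 - i.val := by
    intro i
    simp only [τ, Fin.revPerm_apply, Fin.val_rev]
    omega
  -- The orbit of w is {w, 2n - 2 - w}; it is a single point for the middle vertex w = n - 1.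
  have hsum : ∀ (F : ℕ → ℤ) (w : Fin n), ∑ j : Fin (2 * n - 1) with p j = w, F j =
      F w + if w.val + 1 = n then 0 else F (2 * n - 2 - w) := by
    intro F w
    have hw := w.isLt
    rw [Finset.sum_filter]
    have : ∀ j : Fin (2 * n - 1), (if p j = w then F j else 0) =
        (if j.val = w.val then F w else 0) +
          if j.val = 2 * n - 2 - w then (if w.val + 1 = n then 0 else F (2 * n - 2 - w)) else 0 := by
      intro j
      have hj := j.isLt
      simp only [p, Fin.ext_iff]
      grind
    rw [Finset.sum_congr rfl fun j _ => this j, Finset.sum_add_distrib,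
      Fin.sum_univ_eq_sum_range (fun j => if j = w.val then F w else 0),
      Fin.sum_univ_eq_sum_range (fun j => if j = 2 * n - 2 - w.val then
        (if w.val + 1 = n then 0 else F (2 * n - 2 - w)) else 0)]
    have h1 : w.val < 2 * n - 1 := by omega
    have h2 : 2 * n - 2 - w.val < 2 * n - 1 := by omega
    simp [h1, h2]
  have h : IsFolding (CartanMatrix.A (2 * n - 1)) τ p (CartanMatrix.C n) := by
    refine ⟨?_, ?_, ?_, ?_⟩
    · intro i j
      have hi := i.isLt
      have hj := j.isLt
      simp only [CartanMatrix.A, Matrix.of_apply, hτv, Fin.ext_iff]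
      grind
    · intro w
      have := w.isLt
      exact ⟨⟨w.val, by omega⟩, Fin.ext (by simp only [p]; omega)⟩
    · intro i j
      rw [sameCycle_iff_of_involutive (fun i => Fin.rev_rev i)]
      simp only [Fin.ext_iff, hτv, p]
      have hi := i.isLt
      have hj := j.isLt
      omega
    · intro i w
      have hi := i.isLt
      have hw := w.isLt
      refine Eq.trans ?_ (hsum (fun j => if i.val = j then 2 else
        if i.val + 1 = j ∨ j + 1 = i.val then -1 else 0) w).symm |>.trans
          (Finset.sum_congr rfl fun j _ => ?_)
      · simp only [CartanMatrix.C, Matrix.of_apply, Fin.ext_iff, p]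
        grind
      · simp only [CartanMatrix.A, Matrix.of_apply, Fin.ext_iff]
  refine ⟨τ, p, h, h.extend ?_ ?_ ?_ ?_⟩
  · intro i
    have hi := i.isLt
    simp only [hτv]
    grind
  · intro i
    have hi := i.isLt
    simp only [hτv]
    grind
  · intro w
    have hw := w.isLt
    rw [hsum (fun j => if j = 0 ∨ j + 1 = 2 * n - 1 then -1 else 0) w]
    grind
  · intro i
    have hi := i.isLt
    simp only [p]
    grind

/-! ### Invariant polynomials -/

/-- The homogeneous polynomials of degree `m` that are fixed by all elements of `S`. -/
noncomputable def fixedPoly (S : Set SU2) (m : ℕ) : Submodule ℂ (MvPolynomial (Fin 2) ℂ) where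
  carrier := {v | v.IsHomogeneous m ∧ ∀ g ∈ S, symAction g v = v}
  add_mem' := fun ⟨h1, h2⟩ ⟨h3, h4⟩ =>
    ⟨h1.add h3, fun g hg => by rw [map_add, h2 g hg, h4 g hg]⟩
  zero_mem' := ⟨MvPolynomial.isHomogeneous_zero _ _ _, fun g _ => map_zero _⟩
  smul_mem' c v := fun ⟨h1, h2⟩ => ⟨Submodule.smul_mem
    (MvPolynomial.homogeneousSubmodule (Fin 2) ℂ m) c h1, fun g hg => by rw [map_smul, h2 g hg]⟩

theorem mem_fixedPoly {S : Set SU2} {m : ℕ} {v : MvPolynomial (Fin 2) ℂ} :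
    v ∈ fixedPoly S m ↔ v.IsHomogeneous m ∧ ∀ g ∈ S, symAction g v = v := Iff.rfl

theorem symAction_mul_apply (g h : SU2) (v : MvPolynomial (Fin 2) ℂ) :
    symAction (g * h) v = symAction g (symAction h v) :=
  LinearMap.congr_fun (symAlgebra.map_mul g h) v

theorem symAction_one_apply (v : MvPolynomial (Fin 2) ℂ) : symAction 1 v = v :=
  LinearMap.congr_fun symAlgebra.map_one v

/-- Invariance need only be tested on generators, so neither the elements nor the orders of the
groups have to be known. -/
theorem fixedPoly_closure (S : Set SU2) (m : ℕ) :
    fixedPoly (Subgroup.closure S : Set SU2) m = fixedPoly S m := by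
  ext v
  refine ⟨fun ⟨h1, h2⟩ => ⟨h1, fun g hg => h2 g (Subgroup.subset_closure hg)⟩,
    fun ⟨h1, h2⟩ => ⟨h1, fun g hg => ?_⟩⟩
  induction hg using Subgroup.closure_induction with
  | mem g hg => exact h2 g hg
  | one => exact symAction_one_apply v
  | mul g h _ _ hg hh => rw [symAction_mul_apply, hh, hg]
  | inv g _ hg =>
    conv_lhs => rw [← hg]
    rw [← symAction_mul_apply, inv_mul_cancel, symAction_one_apply]

/-- The homomorphisms from the trivial representation to `π_m` are the invariants. -/
noncomputable def intertwiningEquivFixedPoly (H : Subgroup SU2) (m : ℕ) :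
    Representation.IntertwiningMap (Representation.trivial ℂ H ℂ)
      ((symPower m).comp H.subtype) ≃ₗ[ℂ] fixedPoly (H : Set SU2) m where
  toFun f := ⟨(f 1).1, (f 1).2, fun g hg =>
    (congrArg Subtype.val (f.isIntertwining _ _ ⟨g, hg⟩ 1)).symm⟩
  map_add' _ _ := rfl
  map_smul' _ _ := rfl
  invFun v :=
    { toLinearMap := LinearMap.toSpanSingleton ℂ _ ⟨v.1, v.2.1⟩
      isIntertwining' := fun g => by
        refine LinearMap.ext_ring (Subtype.ext ?_)
        have := v.2.2 g.1 g.2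
        simp only [LinearMap.comp_apply, LinearMap.toSpanSingleton_apply]
        rw [Representation.trivial, MonoidHom.one_apply, Module.End.one_apply, one_smul]
        exact this.symm }
  left_inv f := by
    refine Representation.IntertwiningMap.ext (LinearMap.ext_ring (Subtype.ext ?_))
    simp
  right_inv v := Subtype.ext (by simp)

theorem coeff_poincare_closure (S : Set SU2) (m : ℕ) :
    PowerSeries.coeff m (poincare (Subgroup.closure S)) =
      (Module.finrank ℂ (fixedPoly S m) : ℤ) := by
  rw [poincare, multiplicitySeries, PowerSeries.coeff_mk,
    (intertwiningEquivFixedPoly (Subgroup.closure S) m).finrank_eq, fixedPoly_closure]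

/-- The restriction of the trivial representation is trivial by definition. -/
theorem poincare_eq_poincareRes {H G : Subgroup SU2} (h : H ≤ G) : poincare H = poincareRes h :=
  rfl

/-- Frobenius reciprocity. -/
noncomputable def frobeniusEquiv {G H : Type} [Group G] [Group H] (φ : G →* H)
    {A B : Type} [AddCommGroup A] [Module ℂ A] [AddCommGroup B] [Module ℂ B]
    (ρ : Representation ℂ G A) (τ : Representation ℂ H B) :
    Representation.IntertwiningMap (Representation.ind φ ρ) τ ≃ₗ[ℂ]
      Representation.IntertwiningMap ρ (τ.comp φ) :=
  (Rep.homLinearEquiv (Rep.ind φ (Rep.of ρ)) (Rep.of τ)).symm ≪≫ₗ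
    Rep.indResHomEquiv φ (Rep.of ρ) (Rep.of τ) ≪≫ₗ
    Rep.homLinearEquiv (Rep.of ρ) (Rep.res φ (Rep.of τ))

theorem poincare_eq_poincareInd {H G : Subgroup SU2} (h : H ≤ G) : poincare H = poincareInd h := by
  ext m
  rw [poincare, poincareInd, multiplicitySeries, multiplicitySeries, PowerSeries.coeff_mk,
    PowerSeries.coeff_mk]
  congr 1
  exact (frobeniusEquiv (Subgroup.inclusion h) (Representation.trivial ℂ H ℂ)
    ((symPower m).comp G.subtype)).finrank_eq.symm

/-! ### Generating functions -/

/-- The number of pairs `(a, b)` with `a + b = m` and `N ∣ b - a`. -/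
def cyclicCount (N m : ℕ) : ℕ :=
  ((Finset.range (m + 1)).filter fun a : ℕ => (N : ℤ) ∣ (m : ℤ) - 2 * a).card

/-- The number of pairs `(a, b)` with `a + b = m`, `a ≤ b` and `2 * N ∣ b - a`, where `a` is even
if `a = b`. -/
def dihedralCount (N m : ℕ) : ℕ :=
  ((Finset.range (m + 1)).filter fun a : ℕ =>
    2 * a ≤ m ∧ 2 * N ∣ m - 2 * a ∧ (2 * a = m → Even a)).card

theorem cyclicCount_zero (N : ℕ) : cyclicCount N 0 = 1 := by
  rw [cyclicCount, Finset.card_filter, Finset.sum_range_succ]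
  simp only [Finset.sum_range_zero]
  simp

theorem cyclicCount_one (N : ℕ) : cyclicCount N 1 = if N ∣ 1 then 2 else 0 := by
  rw [cyclicCount, Finset.card_filter, Finset.sum_range_succ, Finset.sum_range_succ]
  have h1 : ((N : ℤ) ∣ ((1 : ℕ) : ℤ) - 2 * ((0 : ℕ) : ℤ)) ↔ N ∣ 1 := by
    rw [← Int.natCast_dvd_natCast]
    simp
  have h2 : ((N : ℤ) ∣ ((1 : ℕ) : ℤ) - 2 * ((1 : ℕ) : ℤ)) ↔ N ∣ 1 := by
    rw [← Int.natCast_dvd_natCast, ← dvd_neg]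
    simp
  simp only [h1, h2, Finset.range_zero, Finset.sum_empty]
  split_ifs <;> rfl

/-- Multiplication by x₀x₁ keeps b - a; the only new pairs are (0, m + 2) and (m + 2, 0). -/
theorem cyclicCount_add_two (N m : ℕ) :
    cyclicCount N (m + 2) = cyclicCount N m + if N ∣ m + 2 then 2 else 0 := by
  rw [cyclicCount, cyclicCount, Finset.card_filter, Finset.card_filter, Finset.sum_range_succ,
    Finset.sum_range_succ']
  have h1 : ((N : ℤ) ∣ ((m + 2 : ℕ) : ℤ) - 2 * ((0 : ℕ) : ℤ)) ↔ N ∣ m + 2 := by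
    rw [← Int.natCast_dvd_natCast]
    simp
  have h2 : ((N : ℤ) ∣ ((m + 2 : ℕ) : ℤ) - 2 * ((m + 1 + 1 : ℕ) : ℤ)) ↔ N ∣ m + 2 := by
    rw [← Int.natCast_dvd_natCast, ← dvd_neg]
    congr! 1
    push_cast
    ring
  have h3 : ∀ a : ℕ, ((N : ℤ) ∣ ((m + 2 : ℕ) : ℤ) - 2 * ((a + 1 : ℕ) : ℤ)) ↔
      ((N : ℤ) ∣ (m : ℤ) - 2 * a) := by
    intro a
    congr! 1
    push_cast
    ring
  simp only [h1, h2, h3]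
  split_ifs <;> omega

/-- Multiplication by (x₀x₁)² keeps b - a and the parity of a; the new pairs have a = 0 or a = 1. -/
theorem dihedralCount_add_four (N m : ℕ) :
    dihedralCount N (m + 4) = dihedralCount N m +
      ((if 2 * N ∣ m + 4 then 1 else 0) + if 2 * N ∣ m + 2 then 1 else 0) := by
  rw [dihedralCount, dihedralCount, Finset.card_filter, Finset.card_filter,
    Finset.sum_range_succ', Finset.sum_range_succ', Finset.sum_range_succ, Finset.sum_range_succ]
  have h0 : (2 * 0 ≤ m + 4 ∧ 2 * N ∣ m + 4 - 2 * 0 ∧ (2 * 0 = m + 4 → Even 0)) ↔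
      2 * N ∣ m + 4 := by
    simp
  have h1 : (2 * (0 + 1) ≤ m + 4 ∧ 2 * N ∣ m + 4 - 2 * (0 + 1) ∧
      (2 * (0 + 1) = m + 4 → Even (0 + 1))) ↔ 2 * N ∣ m + 2 := by
    have : m + 4 - 2 * (0 + 1) = m + 2 := by omega
    rw [this]
    refine ⟨fun h => h.2.1, fun h => ⟨by omega, h, fun h => by omega⟩⟩
  have h2 : ∀ a : ℕ, (2 * (a + 1 + 1) ≤ m + 4 ∧ 2 * N ∣ m + 4 - 2 * (a + 1 + 1) ∧
      (2 * (a + 1 + 1) = m + 4 → Even (a + 1 + 1))) ↔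
      (2 * a ≤ m ∧ 2 * N ∣ m - 2 * a ∧ (2 * a = m → Even a)) := by
    intro a
    have e1 : m + 4 - 2 * (a + 1 + 1) = m - 2 * a := by omega
    have e2 : Even (a + 1 + 1) ↔ Even a := by simp [Nat.even_add_one]
    have e3 : 2 * (a + 1 + 1) ≤ m + 4 ↔ 2 * a ≤ m := by omega
    have e4 : 2 * (a + 1 + 1) = m + 4 ↔ 2 * a = m := by omega
    rw [e1, e2, e3, e4]
  have h3 : ¬ 2 * (m + 1) ≤ m := by omega
  have h4 : ¬ 2 * (m + 1 + 1) ≤ m := by omega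
  simp only [h0, h1, h2, h3, h4, false_and, if_false]
  omega

/-- The strict inequality 2 < m excludes the pair (1, 1): x₀x₁ changes sign under `jSU`. -/
theorem dihedralCount_of_lt_four {N m : ℕ} (hN : N ≠ 0) (hm : m < 4) :
    dihedralCount N m = (if 2 * N ∣ m then 1 else 0) + if 2 < m ∧ 2 * N ∣ m - 2 then 1 else 0 := by
  have h1 : ¬ 2 * N ∣ 1 := fun h => by have := Nat.le_of_dvd one_pos h; omega
  have h3 : ¬ 2 * N ∣ 3 := fun h => by
    have := (dvd_mul_right 2 N).trans h
    omega
  rw [dihedralCount, Finset.card_filter]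
  interval_cases m <;> simp only [Finset.sum_range_succ, Finset.sum_range_zero] <;>
    norm_num [h1, h3]

theorem mk_mul_one_sub_X_pow (f : ℕ → ℤ) (k : ℕ) :
    PowerSeries.mk f * (1 - PowerSeries.X ^ k) =
      PowerSeries.mk fun m => f m - if k ≤ m then f (m - k) else 0 := by
  ext m
  rw [mul_sub, mul_one, map_sub, PowerSeries.coeff_mul_X_pow', PowerSeries.coeff_mk,
    PowerSeries.coeff_mk]
  simp

/-- The factor 1 - t² leaves the new pairs, with series 1 + 2(t^N + t^(2N) + ⋯); the factor 1 - t^N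
then leaves 1 + t^N. -/
theorem cyclicCount_series {N : ℕ} (hN : N ≠ 0) :
    (PowerSeries.mk fun m => (cyclicCount N m : ℤ)) *
      ((1 - PowerSeries.X ^ 2) * (1 - PowerSeries.X ^ N)) = 1 + PowerSeries.X ^ N := by
  have h : ∀ m, (cyclicCount N m : ℤ) - (if 2 ≤ m then (cyclicCount N (m - 2) : ℤ) else 0) =
      if m = 0 then 1 else if N ∣ m then 2 else 0 := by
    rintro (_ | _ | m)
    · simp [cyclicCount_zero]
    · rw [zero_add, cyclicCount_one]
      simp
    · have : m + 1 + 1 - 2 = m := by omega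
      rw [cyclicCount_add_two, this]
      simp
  rw [← mul_assoc, mk_mul_one_sub_X_pow, funext h, mk_mul_one_sub_X_pow]
  ext m
  rw [PowerSeries.coeff_mk, map_add, PowerSeries.coeff_one, PowerSeries.coeff_X_pow]
  rcases lt_trichotomy m N with hm | rfl | hm
  · have h1 : N ∣ m ↔ m = 0 := ⟨fun h => Nat.eq_zero_of_dvd_of_lt h hm, fun h => h ▸ dvd_zero N⟩
    simp only [h1, hm.not_ge, hm.ne, if_false]
    split_ifs <;> rfl
  · simp [hN]
  · have h0 : m ≠ 0 := by omega
    have h1 : m - N ≠ 0 := by omega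
    have h2 : N ∣ m - N ↔ N ∣ m := Nat.dvd_sub_self_right.trans (or_iff_left (by omega))
    simp [h0, h1, h2, hm.le, hm.ne']

/-- The factor 1 - t⁴ leaves the pairs with a = 0, one for each multiple of 2N, and those with a =
1, one for each positive multiple shifted by 2. The factor 1 - t^(2N) cuts this down to two terms.
-/
theorem dihedralCount_series {N : ℕ} (hN : N ≠ 0) :
    (PowerSeries.mk fun m => (dihedralCount N m : ℤ)) *
      ((1 - PowerSeries.X ^ 4) * (1 - PowerSeries.X ^ (2 * N))) =
        1 + PowerSeries.X ^ (2 * N + 2) := by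
  have h : ∀ m, (dihedralCount N m : ℤ) - (if 4 ≤ m then (dihedralCount N (m - 4) : ℤ) else 0) =
      (if 2 * N ∣ m then 1 else 0) + if 2 < m ∧ 2 * N ∣ m - 2 then 1 else 0 := by
    intro m
    rcases lt_or_ge m 4 with hm | hm
    · rw [dihedralCount_of_lt_four hN hm, if_neg hm.not_ge]
      push_cast
      ring
    · obtain ⟨m, rfl⟩ := Nat.exists_eq_add_of_le' hm
      have h1 : m + 4 - 4 = m := by omega
      have h2 : m + 4 - 2 = m + 2 := by omega
      have h3 : 2 < m + 4 := by omega
      simp only [dihedralCount_add_four, h1, h2, h3, hm, if_true, true_and]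
      push_cast
      ring
  rw [← mul_assoc, mk_mul_one_sub_X_pow, funext h, mk_mul_one_sub_X_pow]
  ext m
  rw [PowerSeries.coeff_mk, map_add, PowerSeries.coeff_one, PowerSeries.coeff_X_pow]
  rcases lt_or_ge m (2 * N) with hm | hm
  · have h1 : 2 * N ∣ m ↔ m = 0 :=
      ⟨fun h => Nat.eq_zero_of_dvd_of_lt h hm, fun h => h ▸ dvd_zero _⟩
    have h2 : ¬ (2 < m ∧ 2 * N ∣ m - 2) := by
      rintro ⟨h2, h3⟩
      have := Nat.le_of_dvd (by omega) h3
      omega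
    have h3 : m ≠ 2 * N + 2 := by omega
    simp only [h1, h2, h3, hm.not_ge, if_false]
    split_ifs <;> rfl
  · obtain ⟨j, rfl⟩ := Nat.exists_eq_add_of_le hm
    have h1 : 2 * N ∣ 2 * N + j ↔ 2 * N ∣ j := Nat.dvd_add_self_left
    have h2 : 2 * N + j - 2 * N = j := by omega
    have h3 : 2 * N + j ≠ 0 := by omega
    have h4 : (2 < 2 * N + j ∧ 2 * N ∣ 2 * N + j - 2) ↔ (2 < j ∧ 2 * N ∣ j - 2) ∨ j = 2 := by
      rcases lt_trichotomy j 2 with hj | rfl | hj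
      · refine ⟨fun ⟨h5, h6⟩ => ?_, fun h => by omega⟩
        have := Nat.eq_zero_of_dvd_of_lt h6 (by omega)
        omega
      · simp
        omega
      · have : 2 * N + j - 2 = 2 * N + (j - 2) := by omega
        rw [this, Nat.dvd_add_self_left]
        have : 2 < 2 * N + j := by omega
        simp [this, hj, hj.ne']
    have h5 : 2 * N + j = 2 * N + 2 ↔ j = 2 := by omega
    simp only [h1, h2, h3, h4, h5, hm, if_true, if_false]
    by_cases hj : j = 2
    · subst hj
      simp
    · simp [hj]

/-- Dimensions of the quaternion invariants; the explicit invariants found later exhaust the space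
by comparison with this number. -/
theorem dihedralCount_two_four_mul (k : ℕ) : dihedralCount 2 (4 * k) = k + 1 := by
  induction k with
  | zero => decide
  | succ k ih =>
    have h1 : 2 * 2 ∣ 4 * k + 4 := by omega
    have h2 : ¬ 2 * 2 ∣ 4 * k + 2 := by omega
    rw [mul_add, mul_one, dihedralCount_add_four, ih, if_pos h1, if_neg h2]

theorem dihedralCount_two_four_mul_add_two (k : ℕ) : dihedralCount 2 (4 * k + 2) = k := by
  induction k with
  | zero => decide
  | succ k ih =>
    have h1 : ¬ 2 * 2 ∣ 4 * k + 2 + 4 := by omega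
    have h2 : 2 * 2 ∣ 4 * k + 2 + 2 := by omega
    have h3 : 4 * (k + 1) + 2 = 4 * k + 2 + 4 := by ring
    rw [h3, dihedralCount_add_four, ih, if_neg h1, if_pos h2]

theorem dihedralCount_two_of_odd {m : ℕ} (hm : ¬ 2 ∣ m) : dihedralCount 2 m = 0 := by
  rw [dihedralCount, Finset.card_eq_zero, Finset.filter_eq_empty_iff]
  rintro a - ⟨ha, ⟨c, hc⟩, -⟩
  omega

/-! ### Dimensions of spaces of invariants -/

section Coefficients

open MvPolynomial

/-- The exponent of the monomial `x₀ ^ a * x₁ ^ b`. -/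
noncomputable def expo (a b : ℕ) : Fin 2 →₀ ℕ := Finsupp.single 0 a + Finsupp.single 1 b

@[simp] theorem expo_zero (a b : ℕ) : expo a b 0 = a := by simp [expo]

@[simp] theorem expo_one (a b : ℕ) : expo a b 1 = b := by simp [expo]

theorem eq_expo (d : Fin 2 →₀ ℕ) : d = expo (d 0) (d 1) := by
  ext i
  fin_cases i <;> simp

theorem expo_inj {a b a' b' : ℕ} : expo a b = expo a' b' ↔ a = a' ∧ b = b' := by
  refine ⟨fun h => ⟨?_, ?_⟩, fun ⟨h1, h2⟩ => by rw [h1, h2]⟩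
  · simpa using DFunLike.congr_fun h 0
  · simpa using DFunLike.congr_fun h 1

theorem degree_expo (a b : ℕ) : (expo a b).degree = a + b := by
  simp [expo]

theorem monomial_expo (a b : ℕ) (c : ℂ) :
    monomial (expo a b) c = C c * X 0 ^ a * X 1 ^ b := by
  rw [expo, X_pow_eq_monomial, X_pow_eq_monomial, C_mul_monomial, monomial_mul]
  simp

theorem isHomogeneous_monomial_expo (a b : ℕ) (c : ℂ) :
    (monomial (expo a b) c : MvPolynomial (Fin 2) ℂ).IsHomogeneous (a + b) :=
  isHomogeneous_monomial c (degree_expo a b)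

theorem coeff_monomial_expo (a b a' b' : ℕ) (c : ℂ) :
    coeff (expo a b) (monomial (expo a' b') c) = if a = a' ∧ b = b' then c else 0 := by
  rw [coeff_monomial]
  congr 1
  rw [expo_inj, eq_iff_iff]
  omega

theorem eq_zero_of_coeff_expo {m : ℕ} {v : MvPolynomial (Fin 2) ℂ} (hv : v.IsHomogeneous m)
    (h : ∀ a ≤ m, coeff (expo a (m - a)) v = 0) : v = 0 := by
  ext d
  rw [coeff_zero]
  by_cases hd : d.degree = m
  · rw [eq_expo d] at hd ⊢
    rw [degree_expo] at hd
    have : d 1 = m - d 0 := by omega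
    rw [this]
    exact h _ (by omega)
  · exact hv.coeff_eq_zero hd

/-- A criterion for the dimension of a space of homogeneous polynomials, in terms of the
coefficients of the monomials `x₀ ^ a * x₁ ^ (m - a)` with `a ∈ T`. -/
theorem finrank_eq_card_of_coeff (W : Submodule ℂ (MvPolynomial (Fin 2) ℂ)) (m : ℕ)
    (T : Finset ℕ) (hinj : ∀ v ∈ W, (∀ a ∈ T, coeff (expo a (m - a)) v = 0) → v = 0)
    (hsurj : ∀ a ∈ T, ∃ w ∈ W, ∀ a' ∈ T, coeff (expo a' (m - a')) w = if a' = a then 1 else 0) :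
    Module.finrank ℂ W = T.card := by
  let R : W →ₗ[ℂ] (T → ℂ) :=
    LinearMap.pi fun a => (lcoeff ℂ (expo a.1 (m - a.1))).comp W.subtype
  have hR : ∀ v a, R v a = coeff (expo a.1 (m - a.1)) v.1 := fun _ _ => rfl
  have h1 : Function.Injective R := by
    rw [← LinearMap.ker_eq_bot, LinearMap.ker_eq_bot']
    intro v hv
    refine Subtype.ext (hinj v.1 v.2 fun a ha => ?_)
    rw [← hR v ⟨a, ha⟩, hv]
    rfl
  have h2 : Function.Surjective R := by
    rw [← LinearMap.range_eq_top, eq_top_iff, ← (Pi.basisFun ℂ T).span_eq, Submodule.span_le]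
    rintro _ ⟨a, rfl⟩
    obtain ⟨w, hw, h⟩ := hsurj a.1 a.2
    refine ⟨⟨w, hw⟩, funext fun a' => ?_⟩
    rw [hR, h a'.1 a'.2, Pi.basisFun_apply, Pi.single_apply]
    congr 1
    rw [Subtype.ext_iff]
  rw [(LinearEquiv.ofBijective R ⟨h1, h2⟩).finrank_eq]
  simp

theorem finrank_homogeneousSubmodule (m : ℕ) :
    Module.finrank ℂ (homogeneousSubmodule (Fin 2) ℂ m) = m + 1 := by
  rw [finrank_eq_card_of_coeff _ m (Finset.range (m + 1))]
  · simp
  · intro v hv h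
    exact eq_zero_of_coeff_expo hv fun a ha => h a (Finset.mem_range.2 (by omega))
  · intro a ha
    rw [Finset.mem_range] at ha
    refine ⟨monomial (expo a (m - a)) 1, ?_, fun a' ha' => ?_⟩
    · have := isHomogeneous_monomial_expo a (m - a) 1
      rwa [show a + (m - a) = m by omega] at this
    · rw [coeff_monomial_expo]
      congr 1
      rw [eq_iff_iff]
      omega

instance (m : ℕ) : FiniteDimensional ℂ (homogeneousSubmodule (Fin 2) ℂ m) :=
  Module.finite_of_finrank_pos (by rw [finrank_homogeneousSubmodule]; omega)

instance (S : Set SU2) (m : ℕ) : FiniteDimensional ℂ (fixedPoly S m) :=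
  Submodule.finiteDimensional_of_le (S₂ := homogeneousSubmodule (Fin 2) ℂ m) fun _ hv => hv.1

/-! ### Invariants of diagonal actions and of the binary dihedral groups -/

theorem coeff_aeval_diag (α β : ℂ) (a b : ℕ) (v : MvPolynomial (Fin 2) ℂ) :
    coeff (expo a b) (aeval ![C α * X 0, C β * X 1] v : MvPolynomial (Fin 2) ℂ) =
      α ^ a * β ^ b * coeff (expo a b) v := by
  induction v using MvPolynomial.induction_on' with
  | monomial u c =>
    have : (aeval ![C α * X 0, C β * X 1] (monomial u c) : MvPolynomial (Fin 2) ℂ) =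
        monomial (expo (u 0) (u 1)) (c * α ^ u 0 * β ^ u 1) := by
      rw [aeval_monomial, Finsupp.prod_fintype _ _ (by simp), Fin.prod_univ_two, monomial_expo]
      simp [mul_pow]
      ring
    rw [this, eq_expo u, coeff_monomial_expo, coeff_monomial_expo]
    simp only [expo_zero, expo_one]
    split_ifs with h
    · rw [h.1, h.2]
      ring
    · simp
  | add p q hp hq => rw [map_add, coeff_add, hp, hq, coeff_add, mul_add]

/-- The homogeneous polynomials of degree `m` that are fixed by `x₀ ↦ α x₀`, `x₁ ↦ α⁻¹ x₁`. -/
noncomputable def diagFixed (α : ℂ) (m : ℕ) : Submodule ℂ (MvPolynomial (Fin 2) ℂ) :=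
  homogeneousSubmodule (Fin 2) ℂ m ⊓
    LinearMap.eqLocus (aeval ![C α * X 0, C α⁻¹ * X 1] :
      MvPolynomial (Fin 2) ℂ →ₐ[ℂ] MvPolynomial (Fin 2) ℂ).toLinearMap LinearMap.id

theorem mem_diagFixed {α : ℂ} {m : ℕ} {v : MvPolynomial (Fin 2) ℂ} :
    v ∈ diagFixed α m ↔ v.IsHomogeneous m ∧ aeval ![C α * X 0, C α⁻¹ * X 1] v = v := Iff.rfl

theorem pow_mul_inv_pow_eq_one_iff {α : ℂ} {N : ℕ} (hα : IsPrimitiveRoot α N) (hN : N ≠ 0)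
    {a m : ℕ} (ha : a ≤ m) : α ^ a * α⁻¹ ^ (m - a) = 1 ↔ (N : ℤ) ∣ (m : ℤ) - 2 * a := by
  rw [← dvd_neg, ← hα.zpow_eq_one_iff_dvd, ← zpow_natCast, ← zpow_natCast, _root_.inv_zpow', ←
    zpow_add₀ (hα.ne_zero hN)]
  congr! 2
  push_cast [ha]
  ring

theorem coeff_expo_eq_zero_of_diag {α : ℂ} {N : ℕ} (hα : IsPrimitiveRoot α N) (hN : N ≠ 0)
    {v : MvPolynomial (Fin 2) ℂ} (hv : aeval ![C α * X 0, C α⁻¹ * X 1] v = v) {a m : ℕ}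
    (ha : a ≤ m) (h : ¬ (N : ℤ) ∣ (m : ℤ) - 2 * a) : coeff (expo a (m - a)) v = 0 := by
  have h1 := coeff_aeval_diag α α⁻¹ a (m - a) v
  rw [hv] at h1
  have h2 := mt (pow_mul_inv_pow_eq_one_iff hα hN ha).1 h
  have h3 : (α ^ a * α⁻¹ ^ (m - a) - 1) * coeff (expo a (m - a)) v = 0 := by
    linear_combination -h1
  exact (mul_eq_zero.1 h3).resolve_left (sub_ne_zero.2 h2)

theorem aeval_diag_monomial {α : ℂ} {N : ℕ} (hα : IsPrimitiveRoot α N) (hN : N ≠ 0)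
    {a m : ℕ} (ha : a ≤ m) (h : (N : ℤ) ∣ (m : ℤ) - 2 * a) (c : ℂ) :
    (aeval ![C α * X 0, C α⁻¹ * X 1] (monomial (expo a (m - a)) c) : MvPolynomial (Fin 2) ℂ) =
      monomial (expo a (m - a)) c := by
  have h1 := (pow_mul_inv_pow_eq_one_iff hα hN ha).2 h
  ext d
  rw [eq_expo d, coeff_aeval_diag, coeff_monomial_expo]
  split_ifs with hd
  · rw [hd.1, hd.2, h1, one_mul]
  · rw [mul_zero]

/-- Monomials are eigenvectors, and the fixed ones span. The lemma is used for the cyclic groups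
with N = 2n and for `omegaSU` acting on the two quartics with N = 3. -/
theorem finrank_diagFixed {α : ℂ} {N : ℕ} (hα : IsPrimitiveRoot α N) (hN : N ≠ 0) (m : ℕ) :
    Module.finrank ℂ (diagFixed α m) = cyclicCount N m := by
  refine finrank_eq_card_of_coeff _ m _ ?_ ?_
  · rintro v ⟨hv, hv'⟩ h
    refine eq_zero_of_coeff_expo hv fun a ha => ?_
    by_cases hd : (N : ℤ) ∣ (m : ℤ) - 2 * a
    · exact h a (Finset.mem_filter.2 ⟨Finset.mem_range.2 (by omega), hd⟩)
    · exact coeff_expo_eq_zero_of_diag hα hN hv' ha hd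
  · intro a ha
    obtain ⟨ha, hd⟩ := Finset.mem_filter.1 ha
    rw [Finset.mem_range] at ha
    refine ⟨monomial (expo a (m - a)) 1,
      ⟨?_, aeval_diag_monomial hα hN (by omega) hd 1⟩, fun a' ha' => ?_⟩
    · have := isHomogeneous_monomial_expo a (m - a) 1
      rwa [show a + (m - a) = m by omega] at this
    · rw [coeff_monomial_expo]
      congr 1
      rw [eq_iff_iff]
      rw [Finset.mem_filter, Finset.mem_range] at ha'
      omega

theorem symAction_diagSU (θ : ℝ) : symAction (diagSU θ) =
    aeval ![C (Complex.exp (θ * Complex.I)) * X 0, C (Complex.exp (θ * Complex.I))⁻¹ * X 1] := by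
  have h : (starRingEnd ℂ) (Complex.exp (θ * Complex.I)) = (Complex.exp (θ * Complex.I))⁻¹ := by
    rw [← Complex.exp_conj, ← Complex.exp_neg]
    simp
  apply algHom_ext
  intro i
  fin_cases i
  · simp [symAction, diagSU]
  · simp [symAction, diagSU, h]

theorem isPrimitiveRoot_exp_pi {n : ℕ} (hn : n ≠ 0) :
    IsPrimitiveRoot (Complex.exp ((Real.pi / n : ℝ) * Complex.I)) (2 * n) := by
  convert Complex.isPrimitiveRoot_exp (2 * n) (by omega) using 2
  push_cast
  have : (n : ℂ) ≠ 0 := by exact_mod_cast hn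
  field_simp

theorem finrank_fixedPoly_cyclic {n : ℕ} (hn : n ≠ 0) (m : ℕ) :
    Module.finrank ℂ (fixedPoly {diagSU (Real.pi / n)} m) = cyclicCount (2 * n) m := by
  have h : fixedPoly {diagSU (Real.pi / n)} m =
      diagFixed (Complex.exp ((Real.pi / n : ℝ) * Complex.I)) m := by
    ext v
    rw [mem_fixedPoly, mem_diagFixed, ← symAction_diagSU]
    simp
  rw [h, finrank_diagFixed (isPrimitiveRoot_exp_pi hn) (by omega) m]

theorem symAction_jSU : symAction jSU = aeval ![-X 1, X 0] := by
  apply algHom_ext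
  intro i
  fin_cases i <;> simp [symAction, jSU]

theorem symAction_jSU_monomial (a b : ℕ) (c : ℂ) :
    symAction jSU (monomial (expo a b) c) = monomial (expo b a) ((-1) ^ a * c) := by
  rw [symAction_jSU, monomial_expo, monomial_expo]
  simp [neg_pow (X 1 : MvPolynomial (Fin 2) ℂ)]
  ring

theorem coeff_symAction_jSU (a b : ℕ) (v : MvPolynomial (Fin 2) ℂ) :
    coeff (expo a b) (symAction jSU v) = (-1) ^ b * coeff (expo b a) v := by
  induction v using MvPolynomial.induction_on' with
  | monomial u c =>
    rw [eq_expo u, symAction_jSU_monomial, coeff_monomial_expo, coeff_monomial_expo]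
    by_cases h : a = u 1 ∧ b = u 0
    · rw [if_pos h, if_pos ⟨h.2, h.1⟩, h.2]
    · rw [if_neg h, if_neg fun h' => h ⟨h'.2, h'.1⟩, mul_zero]
  | add p q hp hq => rw [map_add, coeff_add, hp, hq, coeff_add, mul_add]

/-- Since `jSU` maps x₀^a x₁^b to (-1)^a x₀^b x₁^a, an invariant is determined by its coefficients
with a ≤ b. -/
theorem finrank_fixedPoly_dihedral {n : ℕ} (hn : n ≠ 0) (m : ℕ) :
    Module.finrank ℂ (fixedPoly {diagSU (Real.pi / n), jSU} m) = dihedralCount n m := by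
  have hα := isPrimitiveRoot_exp_pi hn
  have hdvd : ∀ a : ℕ, 2 * a ≤ m → (((2 * n : ℕ) : ℤ) ∣ (m : ℤ) - 2 * a ↔ 2 * n ∣ m - 2 * a) := by
    intro a ha
    rw [← Int.natCast_dvd_natCast]
    push_cast [ha]
    rfl
  have hdvd' : ∀ a : ℕ, a ≤ m →
      (((2 * n : ℕ) : ℤ) ∣ (m : ℤ) - 2 * a ↔ ((2 * n : ℕ) : ℤ) ∣ (m : ℤ) - 2 * (m - a : ℕ)) := by
    intro a ha
    rw [← dvd_neg]
    congr! 1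
    push_cast [ha]
    ring
  refine finrank_eq_card_of_coeff _ m _ ?_ ?_
  · rintro v ⟨hv, hv'⟩ h
    have hd := hv' _ (Set.mem_insert _ _)
    have hj := hv' jSU (by simp)
    rw [symAction_diagSU] at hd
    have hhalf : ∀ a, 2 * a ≤ m → coeff (expo a (m - a)) v = 0 := by
      intro a ha
      by_cases h1 : 2 * n ∣ m - 2 * a
      · by_cases h2 : 2 * a = m → Even a
        · exact h a (Finset.mem_filter.2 ⟨Finset.mem_range.2 (by omega), ha, h1, h2⟩)
        · push Not at h2
          -- For odd a the coefficient of (x₀x₁)^a equals its own negative.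
          have h3 := coeff_symAction_jSU a a v
          rw [hj, (Nat.not_even_iff_odd.1 h2.2).neg_one_pow] at h3
          rw [show m - a = a by omega]
          linear_combination h3 / 2
      · exact coeff_expo_eq_zero_of_diag hα (by omega) hd (by omega) (mt (hdvd a ha).1 h1)
    refine eq_zero_of_coeff_expo hv fun a ha => ?_
    rcases le_total (2 * a) m with h1 | h1
    · exact hhalf a h1
    · have h2 := coeff_symAction_jSU a (m - a) v
      have h3 := hhalf (m - a) (by omega)
      rw [show m - (m - a) = a by omega] at h3
      rw [hj, h3, mul_zero] at h2
      exact h2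
  · intro a ha
    obtain ⟨ha', h1, h2, h3⟩ := Finset.mem_filter.1 ha
    have hd := (hdvd a h1).2 h2
    have hhom : ∀ c : ℂ, (monomial (expo a (m - a)) c : MvPolynomial (Fin 2) ℂ).IsHomogeneous m := by
      intro c
      have := isHomogeneous_monomial_expo a (m - a) c
      rwa [show a + (m - a) = m by omega] at this
    have hhom' : ∀ c : ℂ, (monomial (expo (m - a) a) c : MvPolynomial (Fin 2) ℂ).IsHomogeneous m := by
      intro c
      have := isHomogeneous_monomial_expo (m - a) a c
      rwa [show m - a + a = m by omega] at this
    have hfix : ∀ c, symAction (diagSU (Real.pi / n)) (monomial (expo a (m - a)) c) =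
        monomial (expo a (m - a)) c := by
      intro c
      rw [symAction_diagSU]
      exact aeval_diag_monomial hα (by omega) (by omega) hd c
    have hfix' : ∀ c, symAction (diagSU (Real.pi / n)) (monomial (expo (m - a) a) c) =
        monomial (expo (m - a) a) c := by
      intro c
      rw [symAction_diagSU]
      have := aeval_diag_monomial hα (by omega) (Nat.sub_le m a) ((hdvd' a (by omega)).1 hd) c
      rwa [show m - (m - a) = a by omega] at this
    by_cases hm : 2 * a = m
    · refine ⟨monomial (expo a (m - a)) 1, ⟨hhom 1, ?_⟩, ?_⟩
      · rintro g (rfl | rfl)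
        · exact hfix 1
        · rw [symAction_jSU_monomial, (h3 hm).neg_one_pow, one_mul, show m - a = a by omega]
      · intro a' ha'
        rw [coeff_monomial_expo]
        congr 1
        rw [eq_iff_iff]
        rw [Finset.mem_filter, Finset.mem_range] at ha'
        omega
    -- Divisibility of m - 2a by 2n makes m even; hence `jSU` exchanges the two terms of the
    -- symmetrized monomial exactly.
    · have hpar : (-1 : ℂ) ^ (m - a) * (-1) ^ a = 1 := by
        rw [← pow_add]
        refine Even.neg_one_pow ?_
        obtain ⟨c, hc⟩ := h2
        rw [mul_assoc] at hc
        exact ⟨a + n * c, by omega⟩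
      refine ⟨monomial (expo a (m - a)) 1 + monomial (expo (m - a) a) ((-1) ^ a),
        ⟨(hhom 1).add (hhom' _), ?_⟩, ?_⟩
      · rintro g (rfl | rfl)
        · rw [map_add, hfix, hfix']
        · rw [map_add, symAction_jSU_monomial, symAction_jSU_monomial, hpar, mul_one, add_comm]
      · intro a' ha'
        rw [Finset.mem_filter, Finset.mem_range] at ha'
        have h4 : ¬ (a' = m - a ∧ m - a' = a) := by omega
        rw [coeff_add, coeff_monomial_expo, coeff_monomial_expo, if_neg h4, add_zero]
        congr 1
        rw [eq_iff_iff]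
        omega

end Coefficients

/-! ### Invariants of the binary tetrahedral group -/

section Tetrahedral

open MvPolynomial

/-- The polynomial `x₀⁴ + x₁⁴ + s x₀² x₁²`. -/
noncomputable def quartic (s : ℂ) : MvPolynomial (Fin 2) ℂ :=
  X 0 ^ 4 + X 1 ^ 4 + C s * X 0 ^ 2 * X 1 ^ 2

/-- The polynomial `x₀ x₁ (x₀⁴ - x₁⁴)`. -/
noncomputable def sextic : MvPolynomial (Fin 2) ℂ := X 0 * X 1 * (X 0 ^ 4 - X 1 ^ 4)

theorem isHomogeneous_quartic (s : ℂ) : (quartic s).IsHomogeneous 4 := by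
  refine ((isHomogeneous_X_pow 0 4).add (isHomogeneous_X_pow 1 4)).add ?_
  exact ((isHomogeneous_C (Fin 2) s).mul (isHomogeneous_X_pow 0 2)).mul (isHomogeneous_X_pow 1 2)

theorem isHomogeneous_sextic : sextic.IsHomogeneous 6 :=
  ((isHomogeneous_X ℂ 0).mul (isHomogeneous_X ℂ 1)).mul
    ((isHomogeneous_X_pow 0 4).sub (isHomogeneous_X_pow 1 4))

theorem sextic_ne_zero : sextic ≠ 0 := by
  intro h
  have := congrArg (eval ![2, 1]) h
  simp [sextic] at this
  norm_num at this

theorem symAction_aeval (g : SU2) (P Q q : MvPolynomial (Fin 2) ℂ) :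
    symAction g (aeval ![P, Q] q) = aeval ![symAction g P, symAction g Q] q := by
  have : (symAction g).comp (aeval ![P, Q]) = aeval ![symAction g P, symAction g Q] := by
    apply algHom_ext
    intro i
    fin_cases i <;> simp
  exact DFunLike.congr_fun this q

theorem symAction_diagSU_pi_div_two_quartic (s : ℂ) :
    symAction (diagSU (Real.pi / (2 : ℕ))) (quartic s) = quartic s := by
  have h := isPrimitiveRoot_exp_pi two_ne_zero
  rw [symAction_diagSU]
  set α := Complex.exp ((Real.pi / (2 : ℕ) : ℝ) * Complex.I)
  have h1 : α ^ 4 = 1 := h.pow_eq_one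
  have h2 : α⁻¹ ^ 4 = 1 := by rw [inv_pow, h1, inv_one]
  have h3 : α * α⁻¹ = 1 := mul_inv_cancel₀ (h.ne_zero (by norm_num))
  generalize α⁻¹ = β at *
  refine MvPolynomial.funext fun x => ?_
  simp only [quartic, map_add, map_mul, map_pow, aeval_X, aeval_C, algebraMap_eq, eval_C, eval_X,
    Matrix.cons_val_zero, Matrix.cons_val_one]
  linear_combination x 0 ^ 4 * h1 + x 1 ^ 4 * h2 + s * x 0 ^ 2 * x 1 ^ 2 * (α * β + 1) * h3

theorem symAction_diagSU_pi_div_two_sextic :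
    symAction (diagSU (Real.pi / (2 : ℕ))) sextic = sextic := by
  have h := isPrimitiveRoot_exp_pi two_ne_zero
  rw [symAction_diagSU]
  set α := Complex.exp ((Real.pi / (2 : ℕ) : ℝ) * Complex.I)
  have h1 : α ^ 4 = 1 := h.pow_eq_one
  have h2 : α⁻¹ ^ 4 = 1 := by rw [inv_pow, h1, inv_one]
  have h3 : α * α⁻¹ = 1 := mul_inv_cancel₀ (h.ne_zero (by norm_num))
  generalize α⁻¹ = β at *
  refine MvPolynomial.funext fun x => ?_
  simp only [sextic, map_sub, map_mul, map_pow, aeval_X, eval_C, eval_X,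
    Matrix.cons_val_zero, Matrix.cons_val_one]
  linear_combination α * β * x 0 ^ 5 * x 1 * h1 - α * β * x 0 * x 1 ^ 5 * h2 +
    (x 0 ^ 5 * x 1 - x 0 * x 1 ^ 5) * h3

theorem symAction_jSU_quartic (s : ℂ) : symAction jSU (quartic s) = quartic s := by
  rw [symAction_jSU]
  simp only [quartic, map_add, map_mul, map_pow, aeval_X, aeval_C, algebraMap_eq,
    Matrix.cons_val_zero, Matrix.cons_val_one]
  ring

theorem symAction_jSU_sextic : symAction jSU sextic = sextic := by
  rw [symAction_jSU]
  simp only [sextic, map_sub, map_mul, map_pow, aeval_X, Matrix.cons_val_zero,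
    Matrix.cons_val_one]
  ring

theorem symAction_omegaSU : symAction omegaSU =
    aeval ![C ((1 + Complex.I) / 2) * X 0 - C ((1 - Complex.I) / 2) * X 1,
      C ((1 + Complex.I) / 2) * X 0 + C ((1 - Complex.I) / 2) * X 1] := by
  have h : star ((1 + Complex.I) / 2) = (1 - Complex.I) / 2 := by
    rw [Complex.star_def]
    simp [Complex.conj_ofNat, sub_eq_add_neg]
  apply algHom_ext
  intro i
  fin_cases i
  · simp [symAction, omegaSU, -star_div₀, -star_add, h, sub_eq_add_neg]
  · simp [symAction, omegaSU, -star_div₀, -star_add, h]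

/-- With these relations the numbers (1 ± i)/2 can be replaced by variables, and the action of
`omegaSU` becomes a matter of polynomial identities. -/
theorem omega_relations {a b : ℂ} (ha : a = (1 + Complex.I) / 2) (hb : b = (1 - Complex.I) / 2) :
    a * b = 1 / 2 ∧ a ^ 4 = -1 / 4 ∧ b ^ 4 = -1 / 4 := by
  have hI := Complex.I_sq
  refine ⟨?_, ?_, ?_⟩
  · rw [ha, hb]
    linear_combination -hI / 4
  · have : a ^ 2 = Complex.I / 2 := by
      rw [ha]
      linear_combination hI / 4
    linear_combination (a ^ 2 + Complex.I / 2) * this + hI / 4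
  · have : b ^ 2 = -Complex.I / 2 := by
      rw [hb]
      linear_combination hI / 4
    linear_combination (b ^ 2 - Complex.I / 2) * this + hI / 4

/-- The image has coefficient -(2 + s)/4 at x₀⁴ and x₁⁴ and 3 - s/2 at x₀²x₁². It is proportional to
the quartic because 3 - s/2 = -s(2 + s)/4, that is, s² = -12. -/
theorem symAction_omegaSU_quartic {s : ℂ} (hs : s ^ 2 = -12) :
    symAction omegaSU (quartic s) = C (-1 / 2 - s / 4) * quartic s := by
  rw [symAction_omegaSU]
  refine MvPolynomial.funext fun x => ?_
  simp only [quartic, map_add, map_mul, map_pow, aeval_X, aeval_C, algebraMap_eq, eval_C, eval_X,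
    Matrix.cons_val_zero, Matrix.cons_val_one, map_sub]
  obtain ⟨h1, h2, h3⟩ := omega_relations rfl rfl
  generalize (1 + Complex.I) / 2 = a at *
  generalize (1 - Complex.I) / 2 = b at *
  linear_combination (2 + s) * x 0 ^ 4 * h2 + (2 + s) * x 1 ^ 4 * h3 +
    (12 - 2 * s) * x 0 ^ 2 * x 1 ^ 2 * (a * b + 1 / 2) * h1 + x 0 ^ 2 * x 1 ^ 2 / 4 * hs

theorem symAction_omegaSU_sextic : symAction omegaSU sextic = sextic := by
  rw [symAction_omegaSU]
  refine MvPolynomial.funext fun x => ?_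
  simp only [sextic, map_add, map_mul, map_pow, aeval_X, eval_C, eval_X,
    Matrix.cons_val_zero, Matrix.cons_val_one, map_sub]
  obtain ⟨h1, h2, h3⟩ := omega_relations rfl rfl
  generalize (1 + Complex.I) / 2 = a at *
  generalize (1 - Complex.I) / 2 = b at *
  linear_combination -8 * a * b * x 0 ^ 5 * x 1 * h2 + 8 * a * b * x 0 * x 1 ^ 5 * h3 +
    (2 * x 0 ^ 5 * x 1 - 2 * x 0 * x 1 ^ 5) * h1

/-- The numbers x⁴ and y⁴ are chosen as the roots of T² - uT + v², which fixes x²y² up to sign. -/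
theorem exists_pow_four_add_pow_four (u v : ℂ) :
    ∃ x y : ℂ, x ^ 4 + y ^ 4 = u ∧ x ^ 2 * y ^ 2 = v := by
  obtain ⟨r, hr⟩ := IsAlgClosed.exists_pow_nat_eq (u ^ 2 - 4 * v ^ 2) (n := 2) (by norm_num)
  obtain ⟨x, hx⟩ := IsAlgClosed.exists_pow_nat_eq ((u + r) / 2) (n := 4) (by norm_num)
  obtain ⟨y, hy⟩ := IsAlgClosed.exists_pow_nat_eq ((u - r) / 2) (n := 4) (by norm_num)
  have h : (x ^ 2 * y ^ 2 - v) * (x ^ 2 * y ^ 2 + v) = 0 := by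
    linear_combination y ^ 4 * hx + (u + r) / 2 * hy - hr / 4
  rcases mul_eq_zero.1 h with h | h
  · exact ⟨x, y, by linear_combination hx + hy, by linear_combination h⟩
  -- Replacing y by iy keeps y⁴ and corrects the sign of x²y².
  · refine ⟨x, Complex.I * y, ?_, ?_⟩
    · rw [mul_pow, Complex.I_pow_four]
      linear_combination hx + hy
    · rw [mul_pow, Complex.I_sq]
      linear_combination -h

/-- Substitution of the semi-invariant quartic forms. -/
noncomputable def quarticSubst (s : ℂ) : MvPolynomial (Fin 2) ℂ →ₐ[ℂ] MvPolynomial (Fin 2) ℂ :=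
  aeval ![quartic s, quartic (-s)]

/-- The two quartics define a surjection of ℂ² onto itself, so a polynomial that vanishes on its
values is zero. -/
theorem quarticSubst_injective {s : ℂ} (hs : s ≠ 0) : Function.Injective (quarticSubst s) := by
  rw [injective_iff_map_eq_zero]
  intro q hq
  refine MvPolynomial.funext fun z => ?_
  -- The equations are u + sv = z₀ and u - sv = z₁ with u = x⁴ + y⁴ and v = x²y².
  obtain ⟨x, y, h1, h2⟩ :=
    exists_pow_four_add_pow_four ((z 0 + z 1) / 2) ((z 0 - z 1) / (2 * s))
  have h3 : (aeval ![x, y]).comp (quarticSubst s) = (aeval z : MvPolynomial (Fin 2) ℂ →ₐ[ℂ] ℂ) := by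
    apply algHom_ext
    intro i
    have h4 : s * (x ^ 2 * y ^ 2) = (z 0 - z 1) / 2 := by
      rw [h2]
      field_simp
    fin_cases i
    · simp [quarticSubst, quartic]
      linear_combination h1 + h4
    · simp [quarticSubst, quartic]
      linear_combination h1 - h4
  have h5 := DFunLike.congr_fun h3 q
  rw [AlgHom.comp_apply, hq, map_zero] at h5
  rw [map_zero, ← coe_aeval_eq_eval]
  exact h5.symm

theorem isHomogeneous_quarticSubst (s : ℂ) {q : MvPolynomial (Fin 2) ℂ} {k : ℕ}
    (hq : q.IsHomogeneous k) : (quarticSubst s q).IsHomogeneous (4 * k) := by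
  refine hq.aeval _ fun i => ?_
  fin_cases i
  · exact isHomogeneous_quartic s
  · exact isHomogeneous_quartic (-s)

/-- Forms of degree k in the two quartics are invariant and, by injectivity, span dimension k + 1,
which is all of the invariants. -/
theorem fixedPoly_quaternion_four_mul {s : ℂ} (hs : s ≠ 0) (k : ℕ) :
    fixedPoly {diagSU (Real.pi / (2 : ℕ)), jSU} (4 * k) =
      (homogeneousSubmodule (Fin 2) ℂ k).map (quarticSubst s).toLinearMap := by
  symm
  refine Submodule.eq_of_le_of_finrank_eq ?_ ?_
  · rintro _ ⟨q, hq, rfl⟩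
    refine ⟨isHomogeneous_quarticSubst s hq, ?_⟩
    rintro g (rfl | rfl)
    · exact (symAction_aeval _ _ _ _).trans (by
        rw [symAction_diagSU_pi_div_two_quartic, symAction_diagSU_pi_div_two_quartic]
        rfl)
    · exact (symAction_aeval _ _ _ _).trans (by
        rw [symAction_jSU_quartic, symAction_jSU_quartic]
        rfl)
  · rw [← (Submodule.equivMapOfInjective (quarticSubst s).toLinearMap
      (quarticSubst_injective hs) _).finrank_eq, finrank_homogeneousSubmodule,
      finrank_fixedPoly_dihedral two_ne_zero, dihedralCount_two_four_mul]

theorem mulLeft_sextic_injective :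
    Function.Injective (LinearMap.mulLeft ℂ sextic) :=
  mul_right_injective₀ sextic_ne_zero

/-- Multiplication by the invariant sextic is injective, and the spaces in degrees 4k and 4k + 6
both have dimension k + 1. -/
theorem fixedPoly_quaternion_four_mul_add_six (k : ℕ) :
    fixedPoly {diagSU (Real.pi / (2 : ℕ)), jSU} (4 * k + 6) =
      (fixedPoly {diagSU (Real.pi / (2 : ℕ)), jSU} (4 * k)).map (LinearMap.mulLeft ℂ sextic) := by
  symm
  refine Submodule.eq_of_le_of_finrank_eq ?_ ?_
  · rintro _ ⟨q, ⟨hq, hq'⟩, rfl⟩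
    refine ⟨?_, ?_⟩
    · rw [add_comm]
      exact isHomogeneous_sextic.mul hq
    · intro g hg
      rw [LinearMap.mulLeft_apply, map_mul, hq' g hg]
      rcases hg with rfl | rfl
      · rw [symAction_diagSU_pi_div_two_sextic]
      · rw [symAction_jSU_sextic]
  · rw [← (Submodule.equivMapOfInjective _ mulLeft_sextic_injective _).finrank_eq,
      finrank_fixedPoly_dihedral two_ne_zero, finrank_fixedPoly_dihedral two_ne_zero,
      dihedralCount_two_four_mul, show 4 * k + 6 = 4 * (k + 1) + 2 by ring,
      dihedralCount_two_four_mul_add_two]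

/-- The generators of the binary tetrahedral group. -/
def tetrahedralGenerators : Set SU2 := {diagSU (Real.pi / 2), jSU, omegaSU}

theorem mem_fixedPoly_tetrahedral {m : ℕ} {v : MvPolynomial (Fin 2) ℂ} :
    v ∈ fixedPoly tetrahedralGenerators m ↔
      v ∈ fixedPoly {diagSU (Real.pi / (2 : ℕ)), jSU} m ∧ symAction omegaSU v = v := by
  simp only [mem_fixedPoly, tetrahedralGenerators, Set.mem_insert_iff, Set.mem_singleton_iff,
    forall_eq_or_imp, forall_eq, Nat.cast_ofNat, and_assoc]

theorem isPrimitiveRoot_three {s : ℂ} (hs : s ^ 2 = -12) :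
    IsPrimitiveRoot (-1 / 2 - s / 4) 3 := by
  have h1 : (-1 / 2 - s / 4) ^ 3 = 1 := by
    linear_combination (-3 / 32 - s / 64) * hs
  have h2 : -1 / 2 - s / 4 ≠ 1 := by
    intro h
    have : s = -6 := by linear_combination -4 * h
    rw [this] at hs
    norm_num at hs
  have h3 : orderOf (-1 / 2 - s / 4) = 3 := orderOf_eq_prime h1 h2
  have h4 := IsPrimitiveRoot.orderOf (-1 / 2 - s / 4)
  rwa [h3] at h4

/-- In the coordinates given by the quartics, `omegaSU` acts as diag(ζ, ζ⁻¹) with ζ a primitive cube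
root of unity. Its fixed forms are counted as for a cyclic group. -/
theorem finrank_fixedPoly_tetrahedral_four_mul (k : ℕ) :
    Module.finrank ℂ (fixedPoly tetrahedralGenerators (4 * k)) = cyclicCount 3 k := by
  obtain ⟨s, hs⟩ := IsAlgClosed.exists_pow_nat_eq (-12 : ℂ) (n := 2) (by norm_num)
  have hs0 : s ≠ 0 := by
    rintro rfl
    norm_num at hs
  have hζ := isPrimitiveRoot_three hs
  -- The product of the two eigenvalues is 1/4 - s²/16 = 1.
  have hinv : -1 / 2 - (-s) / 4 = (-1 / 2 - s / 4)⁻¹ := by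
    refine eq_inv_of_mul_eq_one_left ?_
    linear_combination -hs / 16
  have hω : ∀ q, symAction omegaSU (quarticSubst s q) = quarticSubst s
      (aeval ![C (-1 / 2 - s / 4) * X 0, C (-1 / 2 - s / 4)⁻¹ * X 1] q) := by
    intro q
    refine (symAction_aeval _ _ _ _).trans ?_
    rw [symAction_omegaSU_quartic hs, symAction_omegaSU_quartic (by rw [neg_sq, hs]), hinv]
    have : aeval ![C (-1 / 2 - s / 4) * quartic s, C (-1 / 2 - s / 4)⁻¹ * quartic (-s)] =
        (quarticSubst s).comp
          (aeval ![C (-1 / 2 - s / 4) * X 0, C (-1 / 2 - s / 4)⁻¹ * X 1]) := by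
      apply algHom_ext
      intro i
      fin_cases i <;> simp [quarticSubst]
    exact DFunLike.congr_fun this q
  have h : fixedPoly tetrahedralGenerators (4 * k) =
      (diagFixed (-1 / 2 - s / 4) k).map (quarticSubst s).toLinearMap := by
    ext v
    rw [mem_fixedPoly_tetrahedral, fixedPoly_quaternion_four_mul hs0]
    constructor
    · rintro ⟨⟨q, hq, rfl⟩, hv⟩
      exact ⟨q, ⟨hq, quarticSubst_injective hs0 ((hω q).symm.trans hv)⟩, rfl⟩
    · rintro ⟨q, ⟨hq, hq'⟩, rfl⟩
      exact ⟨⟨q, hq, rfl⟩, (hω q).trans (congrArg _ hq')⟩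
  rw [h, ← (Submodule.equivMapOfInjective (quarticSubst s).toLinearMap
    (quarticSubst_injective hs0) _).finrank_eq, finrank_diagFixed hζ three_ne_zero]

/-- The sextic is fixed by `omegaSU` too, so it can be cancelled in the invariance condition. -/
theorem finrank_fixedPoly_tetrahedral_four_mul_add_six (k : ℕ) :
    Module.finrank ℂ (fixedPoly tetrahedralGenerators (4 * k + 6)) = cyclicCount 3 k := by
  have h : fixedPoly tetrahedralGenerators (4 * k + 6) =
      (fixedPoly tetrahedralGenerators (4 * k)).map (LinearMap.mulLeft ℂ sextic) := by
    have hω : ∀ q, symAction omegaSU (sextic * q) = sextic * symAction omegaSU q := by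
      intro q
      rw [map_mul, symAction_omegaSU_sextic]
    ext v
    rw [mem_fixedPoly_tetrahedral, fixedPoly_quaternion_four_mul_add_six]
    constructor
    · rintro ⟨⟨q, hq, rfl⟩, hv⟩
      exact ⟨q, mem_fixedPoly_tetrahedral.2
        ⟨hq, mulLeft_sextic_injective ((hω q).symm.trans hv)⟩, rfl⟩
    · rintro ⟨q, hq, rfl⟩
      obtain ⟨hq, hq'⟩ := mem_fixedPoly_tetrahedral.1 hq
      exact ⟨⟨q, hq, rfl⟩, (hω q).trans (congrArg _ hq')⟩
  rw [h, ← (Submodule.equivMapOfInjective _ mulLeft_sextic_injective _).finrank_eq,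
    finrank_fixedPoly_tetrahedral_four_mul]

theorem finrank_fixedPoly_tetrahedral_of_eq_zero {m : ℕ} (hm : dihedralCount 2 m = 0) :
    Module.finrank ℂ (fixedPoly tetrahedralGenerators m) = 0 := by
  rw [← Nat.le_zero, ← hm, ← finrank_fixedPoly_dihedral two_ne_zero]
  exact Submodule.finrank_mono fun v hv => (mem_fixedPoly_tetrahedral.1 hv).1

end Tetrahedral

/-! ### The Poincaré series -/

theorem poincare_cyclicGroup {n : ℕ} (hn : n ≠ 0) :
    poincare (cyclicGroup n) * ((PowerSeries.X ^ (2 * n) - 1) * (PowerSeries.X ^ 2 - 1)) =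
      PowerSeries.X ^ (2 * n) + 1 := by
  have h : poincare (cyclicGroup n) = PowerSeries.mk fun m => (cyclicCount (2 * n) m : ℤ) := by
    ext m
    rw [cyclicGroup, coeff_poincare_closure, finrank_fixedPoly_cyclic hn, PowerSeries.coeff_mk]
  have := cyclicCount_series (N := 2 * n) (by omega)
  rw [h]
  linear_combination this

theorem poincare_binaryDihedral {n : ℕ} (hn : n ≠ 0) :
    poincare (binaryDihedral n) * ((PowerSeries.X ^ (2 * n) - 1) * (PowerSeries.X ^ 4 - 1)) =
      PowerSeries.X ^ (2 * (n + 1)) + 1 := by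
  have h : poincare (binaryDihedral n) = PowerSeries.mk fun m => (dihedralCount n m : ℤ) := by
    ext m
    rw [binaryDihedral, coeff_poincare_closure, finrank_fixedPoly_dihedral hn,
      PowerSeries.coeff_mk]
  have := dihedralCount_series hn
  rw [h, mul_add, mul_one]
  linear_combination this

/-- If Q is the cyclic series modulo 3, the degrees 4k and 4k + 6 together give Q(t⁴)(1 + t⁶). Since
Q(t⁴) has denominator (1 - t⁸)(1 - t¹²), the factor 1 + t⁶ reduces 1 - t¹² to 1 - t⁶. -/
theorem poincare_binaryTetrahedral :
    poincare binaryTetrahedral * ((PowerSeries.X ^ 8 - 1) * (PowerSeries.X ^ 6 - 1)) =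
      PowerSeries.X ^ 12 + 1 := by
  set Q : PowerSeries ℤ := PowerSeries.mk fun m => (cyclicCount 3 m : ℤ) with hQ
  have h : poincare binaryTetrahedral =
      PowerSeries.expand 4 four_ne_zero Q * (1 + PowerSeries.X ^ 6) := by
    ext m
    have h0 : PowerSeries.coeff m (poincare binaryTetrahedral) =
        (Module.finrank ℂ (fixedPoly tetrahedralGenerators m) : ℤ) :=
      coeff_poincare_closure tetrahedralGenerators m
    rw [h0, mul_add, mul_one, map_add, PowerSeries.coeff_mul_X_pow', PowerSeries.coeff_expand,
      PowerSeries.coeff_expand, hQ, PowerSeries.coeff_mk, PowerSeries.coeff_mk]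
    obtain ⟨k, hk | hk | hk⟩ : ∃ k, m = 4 * k ∨ m = 4 * k + 2 ∨ m = 2 * k + 1 := by
      have : m % 4 < 4 := Nat.mod_lt _ (by norm_num)
      rcases Nat.even_or_odd' m with ⟨j, rfl | rfl⟩
      · rcases Nat.even_or_odd' j with ⟨i, rfl | rfl⟩
        · exact ⟨i, Or.inl (by ring)⟩
        · exact ⟨i, Or.inr (Or.inl (by ring))⟩
      · exact ⟨j, Or.inr (Or.inr rfl)⟩
    · subst hk
      have h1 : ¬ (6 ≤ 4 * k ∧ 4 ∣ 4 * k - 6) := by omega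
      rw [finrank_fixedPoly_tetrahedral_four_mul, if_pos (dvd_mul_right 4 k),
        Nat.mul_div_cancel_left k (by norm_num), ← ite_and, if_neg h1, add_zero]
    · subst hk
      have h1 : ¬ 4 ∣ 4 * k + 2 := by omega
      rw [if_neg h1, zero_add]
      -- Degree 2 lies below the sextic and has no invariants; otherwise 4k + 2 = 4(k - 1) + 6.
      rcases k with _ | k
      · rw [finrank_fixedPoly_tetrahedral_of_eq_zero (dihedralCount_two_four_mul_add_two 0)]
        simp
      · have h2 : 4 * (k + 1) + 2 - 6 = 4 * k := by omega
        have h3 : 4 * (k + 1) + 2 = 4 * k + 6 := by omega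
        rw [h2, h3, finrank_fixedPoly_tetrahedral_four_mul_add_six, if_pos (by omega),
          if_pos (dvd_mul_right 4 k), Nat.mul_div_cancel_left k (by norm_num)]
    · have h1 : ¬ 4 ∣ m := by omega
      have h2 : ¬ (6 ≤ m ∧ 4 ∣ m - 6) := by omega
      rw [finrank_fixedPoly_tetrahedral_of_eq_zero (dihedralCount_two_of_odd (by omega)),
        if_neg h1, ← ite_and, if_neg h2]
      rfl
  have h1 := congrArg (PowerSeries.expand 4 four_ne_zero) (cyclicCount_series three_ne_zero)
  simp only [map_mul, map_sub, map_add, map_one, map_pow, PowerSeries.expand_X] at h1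
  rw [h]
  linear_combination h1

/-! ### Inclusions between the groups -/

theorem diagSU_two_mul (θ : ℝ) : diagSU (2 * θ) = diagSU θ * diagSU θ := by
  have h : Complex.exp ((2 * θ : ℝ) * Complex.I) =
      Complex.exp (θ * Complex.I) * Complex.exp (θ * Complex.I) := by
    rw [← Complex.exp_add]
    congr 1
    push_cast
    ring
  apply Subtype.ext
  change !![_, _; _, _] = !![_, _; _, _] * !![_, _; _, _]
  rw [h]
  ext i j
  fin_cases i <;> fin_cases j <;> simp [Matrix.mul_apply, Fin.sum_univ_two]

theorem binaryDihedral_le_binaryTetrahedral : binaryDihedral 2 ≤ binaryTetrahedral := by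
  refine (Subgroup.closure_le _).2 ?_
  rintro g (rfl | rfl)
  · exact Subgroup.subset_closure (by simp)
  · exact Subgroup.subset_closure (by simp)

theorem binaryTetrahedral_le_binaryOctahedral : binaryTetrahedral ≤ binaryOctahedral := by
  refine (Subgroup.closure_le _).2 ?_
  rintro g (rfl | rfl | rfl)
  · rw [show Real.pi / 2 = 2 * (Real.pi / 4) by ring, diagSU_two_mul]
    exact mul_mem (Subgroup.subset_closure (by simp)) (Subgroup.subset_closure (by simp))
  · exact Subgroup.subset_closure (by simp)
  · exact Subgroup.subset_closure (by simp)

theorem binaryDihedral_le_binaryDihedral (n : ℕ) : binaryDihedral n ≤ binaryDihedral (2 * n) := by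
  refine (Subgroup.closure_le _).2 ?_
  rintro g (rfl | rfl)
  · rw [show Real.pi / n = 2 * (Real.pi / (2 * n : ℕ)) by push_cast; field_simp, diagSU_two_mul]
    exact mul_mem (Subgroup.subset_closure (by simp)) (Subgroup.subset_closure (by simp))
  · exact Subgroup.subset_closure (by simp)

theorem cyclicGroup_le_binaryDihedral (n : ℕ) : cyclicGroup n ≤ binaryDihedral n :=
  Subgroup.closure_mono (by simp)

end CoxeterFolding

/-! ### Assembly for the four pairs -/

theorem mainTheorem4 :
    -- the pair `D₄`, `G₂`
    ((∃ τ p, IsFolding (CartanMatrix.D 4) τ p CartanMatrix.G₂ ∧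
        IsFolding (affineD 4) (Equiv.optionCongr τ) (Option.map p) affineG₂) ∧
      (∀ C Ca, IsCoxeter (CartanMatrix.D 4) C → IsCoxeter (affineD 4) Ca →
        charRatio C Ca = (RatFunc.X ^ 3 + 1) / (RatFunc.X ^ 2 - 1) ^ 2 ∧
        ∀ Cf Cfa,
          (IsCoxeter CartanMatrix.G₂ Cf ∧ IsCoxeter affineG₂ Cfa) ∨
            (IsCoxeter CartanMatrix.G₂ᵀ Cf ∧ IsCoxeter affineG₂ᵀ Cfa) →
          charRatio C Ca = charRatio Cf Cfa) ∧
      ∃ h : binaryDihedral 2 ≤ binaryTetrahedral,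
        poincare (binaryDihedral 2) = poincareRes h ∧
        poincare (binaryDihedral 2) = poincareInd h ∧
        poincare (binaryDihedral 2) * (PowerSeries.X ^ 4 - 1) ^ 2 = PowerSeries.X ^ 6 + 1) ∧
    -- the pair `E₆`, `F₄`
    ((∃ τ p, IsFolding CartanMatrix.E₆ τ p CartanMatrix.F₄ ∧
        IsFolding affineE₆ (Equiv.optionCongr τ) (Option.map p) affineF₄) ∧
      (∀ C Ca, IsCoxeter CartanMatrix.E₆ C → IsCoxeter affineE₆ Ca →
        charRatio C Ca =
          (RatFunc.X ^ 6 + 1) / ((RatFunc.X ^ 4 - 1) * (RatFunc.X ^ 3 - 1)) ∧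
        ∀ Cf Cfa,
          (IsCoxeter CartanMatrix.F₄ Cf ∧ IsCoxeter affineF₄ Cfa) ∨
            (IsCoxeter CartanMatrix.F₄ᵀ Cf ∧ IsCoxeter affineF₄ᵀ Cfa) →
          charRatio C Ca = charRatio Cf Cfa) ∧
      ∃ h : binaryTetrahedral ≤ binaryOctahedral,
        poincare binaryTetrahedral = poincareRes h ∧
        poincare binaryTetrahedral = poincareInd h ∧
        poincare binaryTetrahedral * ((PowerSeries.X ^ 8 - 1) * (PowerSeries.X ^ 6 - 1)) =
          PowerSeries.X ^ 12 + 1) ∧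
    -- the pair `D_{n+1}`, `B_n`
    (∀ n : ℕ, 3 ≤ n →
      (∃ τ p, IsFolding (CartanMatrix.D (n + 1)) τ p (CartanMatrix.B n) ∧
        IsFolding (affineD (n + 1)) (Equiv.optionCongr τ) (Option.map p) (affineB n)) ∧
      (∀ C Ca, IsCoxeter (CartanMatrix.D (n + 1)) C → IsCoxeter (affineD (n + 1)) Ca →
        charRatio C Ca =
          (RatFunc.X ^ n + 1) / ((RatFunc.X ^ (n - 1) - 1) * (RatFunc.X ^ 2 - 1)) ∧
        ∀ Cf Cfa,
          (IsCoxeter (CartanMatrix.B n) Cf ∧ IsCoxeter (affineB n) Cfa) ∨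
            (IsCoxeter (CartanMatrix.B n)ᵀ Cf ∧ IsCoxeter (affineB n)ᵀ Cfa) →
          charRatio C Ca = charRatio Cf Cfa) ∧
      ∃ h : binaryDihedral (n - 1) ≤ binaryDihedral (2 * (n - 1)),
        poincare (binaryDihedral (n - 1)) = poincareRes h ∧
        poincare (binaryDihedral (n - 1)) = poincareInd h ∧
        poincare (binaryDihedral (n - 1)) *
            ((PowerSeries.X ^ (2 * (n - 1)) - 1) * (PowerSeries.X ^ 4 - 1)) =
          PowerSeries.X ^ (2 * n) + 1) ∧
    -- the pair `A_{2n-1}`, `C_n`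
    (∀ n : ℕ, 2 ≤ n →
      (∃ τ p, IsFolding (CartanMatrix.A (2 * n - 1)) τ p (CartanMatrix.C n) ∧
        IsFolding (affineA (2 * n - 1)) (Equiv.optionCongr τ) (Option.map p) (affineC n)) ∧
      (∀ C Ca, IsCoxeter (CartanMatrix.A (2 * n - 1)) C →
        IsBicoloredCoxeter (affineA (2 * n - 1)) Ca →
        charRatio C Ca = (RatFunc.X ^ n + 1) / ((RatFunc.X ^ n - 1) * (RatFunc.X - 1)) ∧
        ∀ Cf Cfa,
          (IsCoxeter (CartanMatrix.C n) Cf ∧ IsCoxeter (affineC n) Cfa) ∨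
            (IsCoxeter (CartanMatrix.C n)ᵀ Cf ∧ IsCoxeter (affineC n)ᵀ Cfa) →
          charRatio C Ca = charRatio Cf Cfa) ∧
      ∃ h : cyclicGroup n ≤ binaryDihedral n,
        poincare (cyclicGroup n) = poincareRes h ∧
        poincare (cyclicGroup n) = poincareInd h ∧
        poincare (cyclicGroup n) *
            ((PowerSeries.X ^ (2 * n) - 1) * (PowerSeries.X ^ 2 - 1)) =
          PowerSeries.X ^ (2 * n) + 1) := by
  refine ⟨⟨exists_folding_D₄_G₂, fun C Ca hC hCa => ?_, binaryDihedral_le_binaryTetrahedral,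
      poincare_eq_poincareRes _, poincare_eq_poincareInd _, ?_⟩,
    ⟨exists_folding_E₆_F₄, fun C Ca hC hCa => ⟨charRatio_E₆ hC hCa, fun Cf Cfa h =>
      (charRatio_E₆ hC hCa).trans (charRatio_F₄ h).symm⟩, binaryTetrahedral_le_binaryOctahedral,
      poincare_eq_poincareRes _, poincare_eq_poincareInd _, poincare_binaryTetrahedral⟩,
    fun n hn => ⟨exists_folding_D_B hn, fun C Ca hC hCa => ⟨charRatio_D hn hC hCa, fun Cf Cfa h =>
      (charRatio_D hn hC hCa).trans (charRatio_B hn h).symm⟩,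
      binaryDihedral_le_binaryDihedral (n - 1),
      poincare_eq_poincareRes _, poincare_eq_poincareInd _, ?_⟩,
    fun n hn => ⟨exists_folding_A_C hn, fun C Ca hC hCa => ⟨charRatio_A hn hC hCa, fun Cf Cfa h =>
      (charRatio_A hn hC hCa).trans (charRatio_C hn h).symm⟩, cyclicGroup_le_binaryDihedral n,
      poincare_eq_poincareRes _, poincare_eq_poincareInd _, poincare_cyclicGroup (by omega)⟩⟩
  -- D₄ is the case n = 3 of D_{n+1}, where the two factors of the denominator coincide.
  · have hD : charRatio C Ca = (RatFunc.X ^ 3 + 1) / (RatFunc.X ^ 2 - 1) ^ 2 := by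
      rw [charRatio_D (le_refl 3) hC hCa, sq (RatFunc.X ^ 2 - 1)]
    exact ⟨hD, fun Cf Cfa h => hD.trans (charRatio_G₂ h).symm⟩
  · rw [sq (PowerSeries.X ^ 4 - 1)]
    exact poincare_binaryDihedral two_ne_zero
  · have h := poincare_binaryDihedral (n := n - 1) (by omega)
    rwa [Nat.sub_add_cancel (by omega)] at h
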